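/- Let $X$ be a non-empty compact Hausdorff space, $k\ge 1$ an integer, and $\mathcal M\to X$ a matrix-algebra bundle: a bundle of $C^*$-algebras with local trivializations $\mathcal M|_U\cong U\times M_n(\mathbb C)$, $n\ge 1$, that are $C^*$-isomorphisms on fibres (the size $n$ is locally constant and may vary). Let $\triangleright$ be an action of $\mathbb Z/k$ on $\mathcal M$ by bundle automorphisms over $X$ acting on the fibres by $*$-automorphisms, and let $\mathbb Z/k$ act accordingly on the algebra $\Gamma(\mathcal M)$ of continuous sections. - *Quotient spread.* At $x\in X$ identify $\mathcal M_x\cong M_{n}(\mathbb C)$; the generator $1\in\mathbb Z/k$ acts on it as conjugation by a unitary $v$ with $v^k=1$. Put $\mathrm{qt}_x:=\lceil \max_j d_j/\min_j d_j\rceil$, where $d_j\ge 0$ is the dimension of the eigenspace of $v$ in $\mathbb C^n$ for $e^{2\pi i j/k}$, $0\le j<k$, and $\mathrm{qt}_x:=\infty$ if $\min_j d_j=0$. This does not depend on the choices. Put $\mathrm{qt}:=\sup_{x\in X}\mathrm{qt}_x$. - *Index.* $\mathrm{ix}(\mathcal M,\triangleright)$ is the smallest $m$ for which $X$ has an open cover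 $U_0,\dots,U_m$ such that over each $U_i$ the bundle $\mathcal M$ is trivial, and the action of $1\in\mathbb Z/k$ is conjugation by a continuous unitary section $s_i$ of $\mathcal M|_{U_i}$ with $s_i^k=1$ whose eigenbundles (in the trivialization of $\mathcal M|_{U_i}$) are all trivial; where ranks are only locally constant, "trivial over $U_i$" means that $U_i$ is a finite disjoint union of open sets over each of which the bundle is a product bundle of constant rank. ($\mathrm{ix}=\infty$ if there is no such $m$.) - *Weak local-triviality dimension.* $\dim^{\mathbb Z/k}_{\mathrm{WLT}}(\Gamma(\mathcal M))$ is the infimum in $\mathbb N\cup\{\infty\}$ of the $n\in\mathbb N$ for which there are $\mathbb Z/k$-equivariant $*$-homomorphisms $\rho_0,\dots,\rho_n: C_0((0,1])\otimes C(\mathbb Z/k)\to\Gamma(\mathcal M)$ with $\sum_{j=0}^n\rho_j(t\otimes 1)$ invertible, where $t$ is the identity function on $(0,1]$ and $\mathbb Z/k$ acts on $C(\mathbb Z/k)$ by translation. Then, in $\mathbb N\cup\{\infty\}$, $$\mathrm{qt}-1\;\le\;\dim^{\mathbb Z/k}_{\mathrm{WLT}}(\Gamma(\mathcal M))\;\le\;\mathrm{qt}\cdot\bigl(\mathrm{ix}(\mathcal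 M,\triangleright)+1\bigr)-1 .$$ -/

import Mathlib

universe u v

open scoped Real

/-! ### Matrix-algebra bundles, their sections, and cyclic group actions -/

/-- The total space of a family of fibres, with its projection. -/
abbrev FiberTotal {X : Type u} (E : X → Type v) : Type (max u v) :=
  Bundle.TotalSpace PUnit.{1} E

/-- A matrix-algebra bundle over `X`: a family of C*-algebras with a topology on the total space
that has local trivializations `M|_U ≅ U × M_n(ℂ)`, `n ≥ 1`, which are isomorphisms of
C*-algebras on the fibres. The size `n` is locally constant and may vary. -/
structure MatrixBundle (X : Type u) [TopologicalSpace X] where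
  Fiber : X → Type v
  [cstar : ∀ x, CStarAlgebra (Fiber x)]
  [topTotal : TopologicalSpace (FiberTotal Fiber)]
  locallyTrivial : ∀ x : X, ∃ n : ℕ, 0 < n ∧
    ∃ e : Bundle.Trivialization (Matrix (Fin n) (Fin n) ℂ)
        (Bundle.TotalSpace.proj : FiberTotal Fiber → X),
      x ∈ e.baseSet ∧ ∀ y ∈ e.baseSet, ∃ φ : Fiber y ≃⋆ₐ[ℂ] Matrix (Fin n) (Fin n) ℂ,
        ∀ a : Fiber y, (e ⟨y, a⟩).2 = φ a

namespace MatrixBundle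

attribute [instance] MatrixBundle.cstar MatrixBundle.topTotal

variable {X : Type u} [TopologicalSpace X] (M : MatrixBundle.{u, v} X)

/-- The total space of the bundle. -/
abbrev Total : Type (max u v) := FiberTotal M.Fiber

/-- A trivialization `M|_V ≅ V × M_n(ℂ)` of `M` as a matrix bundle over the open set
`V = e.baseSet`: it is an isomorphism of C*-algebras on each fibre. -/
def IsMatrixTrivialization {n : ℕ}
    (e : Bundle.Trivialization (Matrix (Fin n) (Fin n) ℂ)
      (Bundle.TotalSpace.proj : M.Total → X)) : Prop :=
  ∀ y ∈ e.baseSet, ∃ φ : M.Fiber y ≃⋆ₐ[ℂ] Matrix (Fin n) (Fin n) ℂ,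
    ∀ a : M.Fiber y, (e ⟨y, a⟩).2 = φ a

/-- Continuity of a (not necessarily continuous) section can be read in local trivializations. -/
theorem continuous_section_iff (s : ∀ x, M.Fiber x) :
    Continuous (fun x => (⟨x, s x⟩ : M.Total)) ↔
      ∀ (n : ℕ) (e : Bundle.Trivialization (Matrix (Fin n) (Fin n) ℂ)
        (Bundle.TotalSpace.proj : M.Total → X)), M.IsMatrixTrivialization e →
        ∀ x ∈ e.baseSet, ContinuousAt (fun y => (e ⟨y, s y⟩).2) x := by
  constructor
  · intro h n e _ x hx
    exact ((e.tendsto_nhds_iff (e.mem_source.2 hx)).1 (h.tendsto x)).2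
  · intro h
    rw [continuous_iff_continuousAt]
    intro x
    obtain ⟨n, -, e, hx, he⟩ := M.locallyTrivial x
    exact (e.tendsto_nhds_iff (z := (⟨x, s x⟩ : M.Total)) (e.mem_source.2 hx)).2
      ⟨continuous_id.tendsto x, h n e he x hx⟩

/-- The *-algebra `Γ(M)` of continuous sections of `M`, with pointwise operations. -/
def sections : StarSubalgebra ℂ (∀ x, M.Fiber x) where
  carrier := {s | Continuous (fun x => (⟨x, s x⟩ : M.Total))}
  mul_mem' := by
    intro s t hs ht
    simp only [Set.mem_ofPred_eq, continuous_section_iff] at hs ht ⊢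
    intro n e he x hx
    refine ((hs n e he x hx).mul (ht n e he x hx)).congr ?_
    filter_upwards [e.open_baseSet.mem_nhds hx] with y hy
    obtain ⟨φ, hφ⟩ := he y hy
    simp [hφ]
  add_mem' := by
    intro s t hs ht
    simp only [Set.mem_ofPred_eq, continuous_section_iff] at hs ht ⊢
    intro n e he x hx
    refine ((hs n e he x hx).add (ht n e he x hx)).congr ?_
    filter_upwards [e.open_baseSet.mem_nhds hx] with y hy
    obtain ⟨φ, hφ⟩ := he y hy
    simp [hφ]
  algebraMap_mem' := by
    intro c
    simp only [Set.mem_ofPred_eq, continuous_section_iff]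
    intro n e he x hx
    refine (continuousAt_const (y := algebraMap ℂ (Matrix (Fin n) (Fin n) ℂ) c)).congr ?_
    filter_upwards [e.open_baseSet.mem_nhds hx] with y hy
    obtain ⟨φ, hφ⟩ := he y hy
    simp only [hφ, Pi.algebraMap_apply, Algebra.algebraMap_eq_smul_one, map_smul, map_one]
  star_mem' := by
    intro s hs
    simp only [Set.mem_ofPred_eq, continuous_section_iff] at hs ⊢
    intro n e he x hx
    refine (hs n e he x hx).star.congr ?_
    filter_upwards [e.open_baseSet.mem_nhds hx] with y hy
    obtain ⟨φ, hφ⟩ := he y hy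
    simp [hφ, map_star]

theorem mem_sections {s : ∀ x, M.Fiber x} :
    s ∈ M.sections ↔ Continuous (fun x => (⟨x, s x⟩ : M.Total)) := Iff.rfl

/-- An action of `ℤ/k` on the matrix bundle `M` by bundle automorphisms over `X`: on each fibre it
acts by *-automorphisms, and each group element acts continuously on the total space. -/
structure CyclicAction (k : ℕ) where
  act : ∀ x, Multiplicative (ZMod k) →* (M.Fiber x ≃⋆ₐ[ℂ] M.Fiber x)
  continuous_act : ∀ g, Continuous (fun p : M.Total => (⟨p.1, act p.1 g p.2⟩ : M.Total))

namespace CyclicAction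

variable {M} {k : ℕ} (T : M.CyclicAction k)

theorem act_mem_sections (g : Multiplicative (ZMod k)) {s : ∀ x, M.Fiber x}
    (hs : s ∈ M.sections) : (fun x => T.act x g (s x)) ∈ M.sections :=
  (T.continuous_act g).comp hs

/-- The induced action of `ℤ/k` on the section algebra `Γ(M)`: `(g • s)(x) = g • s(x)`. -/
def onSections : Multiplicative (ZMod k) →* (M.sections ≃⋆ₐ[ℂ] M.sections) where
  toFun g :=
    { toFun := fun s => ⟨fun x => T.act x g (s.1 x), T.act_mem_sections g s.2⟩
      invFun := fun s => ⟨fun x => T.act x g⁻¹ (s.1 x), T.act_mem_sections g⁻¹ s.2⟩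
      left_inv := fun s => by
        ext x
        change (T.act x g⁻¹ * T.act x g) (s.1 x) = s.1 x
        rw [← map_mul, inv_mul_cancel, map_one]; rfl
      right_inv := fun s => by
        ext x
        change (T.act x g * T.act x g⁻¹) (s.1 x) = s.1 x
        rw [← map_mul, mul_inv_cancel, map_one]; rfl
      map_mul' := fun s t => by ext x; exact map_mul (T.act x g) _ _
      map_add' := fun s t => by ext x; exact map_add (T.act x g) _ _
      map_star' := fun s => by ext x; exact map_star (T.act x g) _
      map_smul' := fun c s => by ext x; exact map_smul (T.act x g) c _ }
  map_one' := by
    ext s x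
    change T.act x 1 (s.1 x) = s.1 x
    rw [map_one]; rfl
  map_mul' g h := by
    ext s x
    change T.act x (g * h) (s.1 x) = T.act x g (T.act x h (s.1 x))
    rw [map_mul]; rfl

end CyclicAction

end MatrixBundle

/-! ### The weak local-triviality dimension -/

/-- `C_0((0,1])`, realised as the continuous functions on `[0,1]` that vanish at `0`. -/
abbrev ConeAlgebra : Type := ContinuousMapZero unitInterval ℂ

/-- The identity function `t` of `C_0((0,1])`. -/
def coneCoordinate : ConeAlgebra where
  toFun := fun r => ((r : ℝ) : ℂ)
  continuous_toFun := by fun_prop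
  map_zero' := by simp

/-- The *-algebra `C_0((0,1]) ⊗ C(ℤ/k)`, that is, the functions from the finite group `ℤ/k` to
`C_0((0,1])`, with pointwise operations. Here `t ⊗ 1` is the constant function `t`. -/
abbrev EquivariantCone (k : ℕ) : Type := ZMod k → ConeAlgebra

/-- The weak local-triviality dimension of an action of `ℤ/k` on a unital *-algebra `A`: the
infimum of the `n` for which there are `n + 1` equivariant *-homomorphisms
`ρ_j : C_0((0,1]) ⊗ C(ℤ/k) → A`, where `ℤ/k` acts on `C(ℤ/k)` by translation, such that
`∑ j, ρ_j (t ⊗ 1)` is invertible in `A`. It is `⊤` if there is no such `n`. -/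
noncomputable def weakLTDim {k : ℕ} {A : Type*} [Ring A] [StarRing A] [Algebra ℂ A]
    (α : Multiplicative (ZMod k) →* (A ≃⋆ₐ[ℂ] A)) : ℕ∞ :=
  sInf {m : ℕ∞ | ∃ n : ℕ, m = n ∧ ∃ ρ : Fin (n + 1) → (EquivariantCone k →⋆ₙₐ[ℂ] A),
    (∀ j (g : ZMod k) (f : EquivariantCone k),
      ρ j (fun h => f (h + g)) = α (Multiplicative.ofAdd g) (ρ j f)) ∧
    IsUnit (∑ j, ρ j (fun _ => coneCoordinate))}

/-! ### The quotient spread -/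

/-- The eigenspace in `ℂ^n` of the matrix `v` for `ζ^j`, where `ζ = exp(2πi/k)`. -/
noncomputable def rootEigenspace (k : ℕ) {n : ℕ} (v : Matrix (Fin n) (Fin n) ℂ) (j : Fin k) :
    Submodule ℂ (Fin n → ℂ) :=
  Module.End.eigenspace (Matrix.toLin' v) (Complex.exp (2 * π * Complex.I / k) ^ (j : ℕ))

/-- The quotient spread `⌈max dim / min dim⌉` of a matrix `v` with `v^k = 1`, the maximum and the
minimum being over the (possibly zero) eigenspaces of `v` for all the `k`-th roots of unity; it is
`⊤` when the minimum is zero. -/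
noncomputable def matrixSpread (k : ℕ) {n : ℕ} (v : Matrix (Fin n) (Fin n) ℂ) : ℕ∞ :=
  let dmax : ℕ := ⨆ j : Fin k, Module.finrank ℂ (rootEigenspace k v j)
  let dmin : ℕ := ⨅ j : Fin k, Module.finrank ℂ (rootEigenspace k v j)
  if dmin = 0 then ⊤ else ((⌈(dmax : ℚ) / (dmin : ℚ)⌉₊ : ℕ) : ℕ∞)

namespace MatrixBundle

namespace CyclicAction

variable {X : Type u} [TopologicalSpace X] {M : MatrixBundle.{u, v} X} {k : ℕ}
  (T : M.CyclicAction k)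

/-- `v` is a unitary matrix with `v^k = 1` that induces the action on the fibre `M_x`, which is
identified with `M_n(ℂ)` by `φ`: the generator `1 ∈ ℤ/k` acts as conjugation by `v`. -/
def IsFiberGenerator (x : X) {n : ℕ} (φ : M.Fiber x ≃⋆ₐ[ℂ] Matrix (Fin n) (Fin n) ℂ)
    (v : Matrix (Fin n) (Fin n) ℂ) : Prop :=
  v ∈ unitary (Matrix (Fin n) (Fin n) ℂ) ∧ v ^ k = 1 ∧
    ∀ a : M.Fiber x, φ (T.act x (Multiplicative.ofAdd 1) a) = v * φ a * star v

/-- The quotient spread `qt_x` of the action on the fibre at `x`, computed from a unitary that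
induces the action. Such a unitary exists and the spread does not depend on the choices, so the
supremum over all choices is the common value. -/
noncomputable def fiberSpread (x : X) : ℕ∞ :=
  sSup {q : ℕ∞ | ∃ (n : ℕ) (φ : M.Fiber x ≃⋆ₐ[ℂ] Matrix (Fin n) (Fin n) ℂ)
    (v : Matrix (Fin n) (Fin n) ℂ), T.IsFiberGenerator x φ v ∧ q = matrixSpread k v}

/-- The global quotient spread `qt = sup_x qt_x`. -/
noncomputable def quotientSpread : ℕ∞ := ⨆ x : X, T.fiberSpread x

/-! ### The index of an action -/

/-- Over the open set `V`: `M` is isomorphic to `V × M_n(ℂ)`, the action is inner, induced by a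
continuous unitary section `s` with `s^k = 1`, and every eigenbundle of `s` (a subbundle of
`V × ℂ^n` in the trivialization) is isomorphic to a product `V × ℂ^d`, that is, it has a global
frame of `d` continuous sections. -/
def IsTrivialOver (V : Set X) : Prop :=
  ∃ (n : ℕ) (e : Bundle.Trivialization (Matrix (Fin n) (Fin n) ℂ)
      (Bundle.TotalSpace.proj : M.Total → X)) (s : ∀ x, M.Fiber x),
    M.IsMatrixTrivialization e ∧ e.baseSet = V ∧
    ContinuousOn (fun x => (⟨x, s x⟩ : M.Total)) V ∧
    (∀ x ∈ V, s x ∈ unitary (M.Fiber x) ∧ s x ^ k = 1 ∧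
      ∀ a : M.Fiber x, T.act x (Multiplicative.ofAdd 1) a = s x * a * star (s x)) ∧
    ∀ j : Fin k, ∃ (d : ℕ) (b : Fin d → X → (Fin n → ℂ)),
      (∀ i, ContinuousOn (b i) V) ∧
      ∀ x ∈ V, LinearIndependent ℂ (fun i => b i x) ∧
        Submodule.span ℂ (Set.range fun i => b i x) = rootEigenspace k (e ⟨x, s x⟩).2 j

/-- Triviality over an open set `U` when ranks are only locally constant: `U` is the disjoint
union of finitely many open sets over each of which (with constant ranks) `M` and the eigenbundles
of a unitary section inducing the action are trivial. -/
def IsPiecewiseTrivialOver (U : Set X) : Prop :=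
  ∃ (r : ℕ) (V : Fin r → Set X), (∀ a, IsOpen (V a)) ∧
    Pairwise (Function.onFun Disjoint V) ∧ U = ⋃ a, V a ∧ ∀ a, T.IsTrivialOver (V a)

/-- The index `ix(M, ▷)`: the smallest `m` such that `X` has an open cover `U_0, …, U_m` with `M`,
the action and the eigenbundles trivial over each `U_i`. It is `⊤` if there is no such `m`. -/
noncomputable def index : ℕ∞ :=
  sInf {q : ℕ∞ | ∃ m : ℕ, q = m ∧ ∃ U : Fin (m + 1) → Set X,
    (∀ i, IsOpen (U i)) ∧ (⋃ i, U i) = Set.univ ∧ ∀ i, T.IsPiecewiseTrivialOver (U i)}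

end CyclicAction

end MatrixBundle

/-!
For a character `χ` of `ℤ/k` and an equivariant *-homomorphism `ρ` from `C_0((0,1]) ⊗ C(ℤ/k)` to
`M_n(ℂ)`, where the generator of `ℤ/k` acts on `M_n(ℂ)` as conjugation by a unitary `v`, the element
`c = ρ(√t ⊗ χ)` satisfies `v c = χ(1) c v`.
Hence `c` maps each eigenspace of `v` to the one whose eigenvalue is `χ(1)` times as large, while
`c* c = ρ(t ⊗ 1)`.

*Lower bound.* It follows that the rank of `ρ(t ⊗ 1)` on any eigenspace of `v` is at most the
dimension of any other eigenspace. If `N + 1` such elements have an invertible sum, then each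
eigenspace has dimension at most `N + 1` times that of any other. This is
`matrixSpread_le_of_equivariant`, applied to the fibres of `M`.

*Upper bound.* Let `q` be the spread, and let `V` be an open set over which everything is trivial.
An orthonormalization of the frames of the eigenbundles diagonalizes the inducing unitary section by
a continuous unitary (`exists_continuousOn_diagonalization`), so that it suffices to treat a
constant diagonal matrix. If `D` is its smallest multiplicity, a choice of `D` basis vectors in each
eigenspace spans a multiple of the regular representation of `ℤ/k`, on which `C(ℤ/k)` acts
equivariantly by projections that come from the finite Fourier transform. As all multiplicities lie
between `D` and `q D`, `q` such choices cover the whole space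
(`exists_cyclicSystems_rootDiagonal`). Cut off by a partition of unity subordinate to a
cover with `m + 1` members, these give `q (m + 1)` equivariant *-homomorphisms to `Γ(M)`. The
values at `t ⊗ 1` add up to a nonnegative combination of projections; at each point those with
positive coefficients have an invertible sum, hence so has the whole combination
(`isUnit_sum_smul_of_projections`). The section so obtained is invertible because it is so at
each point.

The case of infinite index needs in addition that the spread is not zero, that is, that the action
on some fibre is induced by a unitary of order dividing `k`. This is the Skolem–Noether theorem with
a rescaling (`exists_unitary_conj_pow_eq_one`).
-/

/-! ### Eigenspaces for roots of unity -/

/-- The number `exp(2πi/k)^j` is the value at `j` of the standard additive character of `ℤ/k`. -/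
theorem exp_pow_eq_stdAddChar (k : ℕ) [NeZero k] (j : ℕ) :
    Complex.exp (2 * π * Complex.I / k) ^ j = ZMod.stdAddChar (N := k) (j : ZMod k) := by
  have := ZMod.stdAddChar_coe (N := k) (j : ℤ)
  push_cast at this
  rw [this, ← Complex.exp_nat_mul]
  congr 1
  ring

theorem mem_rootEigenspace {k : ℕ} [NeZero k] {n : ℕ} {v : Matrix (Fin n) (Fin n) ℂ} {j : Fin k}
    {ξ : Fin n → ℂ} :
    ξ ∈ rootEigenspace k v j ↔ v.mulVec ξ = ZMod.stdAddChar (N := k) ((j : ℕ) : ZMod k) • ξ := by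
  rw [rootEigenspace, Module.End.mem_eigenspace_iff, exp_pow_eq_stdAddChar, Matrix.toLin'_apply]

theorem pow_val_add_one {M : Type*} [Monoid M] {k : ℕ} [NeZero k] {a : M} (ha : a ^ k = 1)
    (m : ZMod k) : a ^ (m + 1).val = a ^ m.val * a := by
  rw [ZMod.val_add, ← pow_eq_pow_mod _ ha, ZMod.val_one_eq_one_mod, pow_add, ← pow_eq_pow_mod _ ha,
    pow_one]

theorem natCast_fin_bijective (k : ℕ) [NeZero k] :
    Function.Bijective (fun j : Fin k => ((j : ℕ) : ZMod k)) := by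
  rw [Fintype.bijective_iff_injective_and_card]
  refine ⟨fun i j h => ?_, by simp [ZMod.card]⟩
  have := (ZMod.natCast_eq_natCast_iff' _ _ _).1 h
  rw [Nat.mod_eq_of_lt i.2, Nat.mod_eq_of_lt j.2] at this
  exact Fin.ext this

/-- Orthogonality of the characters of `ℤ/k`. -/
theorem sum_stdAddChar_mul (k : ℕ) [NeZero k] (b : ZMod k) :
    ∑ x : ZMod k, ZMod.stdAddChar (N := k) (x * b) = if b = 0 then (k : ℂ) else 0 := by
  rw [AddChar.sum_mulShift b (ZMod.isPrimitive_stdAddChar k)]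
  split_ifs <;> simp [ZMod.card]

/-- A matrix with `v^k = 1` is diagonalizable: its eigenspaces for the `k`-th roots of unity
span. -/
theorem iSup_rootEigenspace_eq_top {k : ℕ} [NeZero k] {n : ℕ} {v : Matrix (Fin n) (Fin n) ℂ}
    (hv : v ^ k = 1) : ⨆ j, rootEigenspace k v j = ⊤ := by
  rw [eq_top_iff]
  intro ξ _
  -- The component of `ξ` in the `j`-th eigenspace is its Fourier coefficient along `m ↦ v^m ξ`.
  let c : ZMod k → (Fin n → ℂ) := fun j =>
    ∑ m : ZMod k, ZMod.stdAddChar (N := k) (m * -j) • (v ^ m.val).mulVec ξ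
  have hc : ∀ j, v.mulVec (c j) = ZMod.stdAddChar (N := k) j • c j := by
    intro j
    simp only [c, Matrix.mulVec_sum, Matrix.mulVec_smul, Matrix.mulVec_mulVec, Finset.smul_sum,
      smul_smul, ← AddChar.map_add_eq_mul]
    refine Fintype.sum_equiv (Equiv.addRight 1) _ _ fun m => ?_
    simp only [Equiv.coe_addRight, pow_val_add_one hv, (Commute.pow_self v _).eq]
    congr 2
    ring
  have hsum : ∑ j : Fin k, c ((j : ℕ) : ZMod k) = (k : ℂ) • ξ := by
    rw [(natCast_fin_bijective k).sum_comp c]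
    simp only [c]
    rw [Finset.sum_comm]
    simp only [← Finset.sum_smul]
    have : ∀ m : ZMod k, ∑ i : ZMod k, ZMod.stdAddChar (N := k) (m * -i) =
        if m = 0 then (k : ℂ) else 0 := by
      intro m
      have h := sum_stdAddChar_mul k (-m)
      simp only [neg_eq_zero] at h
      rw [← h]
      exact Finset.sum_congr rfl fun i _ => by congr 1; ring
    simp_rw [this]
    simp
  have hk : (k : ℂ) ≠ 0 := by exact_mod_cast NeZero.ne k
  have : ξ = (k : ℂ)⁻¹ • ∑ j : Fin k, c ((j : ℕ) : ZMod k) := by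
    rw [hsum, smul_smul, inv_mul_cancel₀ hk, one_smul]
  rw [this]
  refine Submodule.smul_mem _ _ (Submodule.sum_mem _ fun j _ => ?_)
  exact Submodule.mem_iSup_of_mem j (mem_rootEigenspace.2 (hc _))

theorem matrixSpread_le_natCast_iff {k : ℕ} [NeZero k] {n : ℕ} {v : Matrix (Fin n) (Fin n) ℂ}
    {N : ℕ} : matrixSpread k v ≤ N ↔
      (∀ j, 0 < Module.finrank ℂ (rootEigenspace k v j)) ∧
      ∀ i j, Module.finrank ℂ (rootEigenspace k v i) ≤
        N * Module.finrank ℂ (rootEigenspace k v j) := by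
  obtain ⟨a, ha⟩ := exists_eq_ciSup_of_finite
    (f := fun j : Fin k => Module.finrank ℂ (rootEigenspace k v j))
  obtain ⟨b, hb⟩ := exists_eq_ciInf_of_finite
    (f := fun j : Fin k => Module.finrank ℂ (rootEigenspace k v j))
  have hle : ∀ j, Module.finrank ℂ (rootEigenspace k v j) ≤
      Module.finrank ℂ (rootEigenspace k v a) := fun j => by
    rw [ha]; exact le_ciSup (f := fun j : Fin k => Module.finrank ℂ (rootEigenspace k v j))
      (Set.finite_range _).bddAbove j
  have hge : ∀ j, Module.finrank ℂ (rootEigenspace k v b) ≤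
      Module.finrank ℂ (rootEigenspace k v j) := fun j => by
    rw [hb]; exact ciInf_le (f := fun j : Fin k => Module.finrank ℂ (rootEigenspace k v j))
      (Set.finite_range _).bddBelow j
  unfold matrixSpread
  simp only [← ha, ← hb]
  split_ifs with h
  · simp only [top_le_iff, ENat.natCast_ne_top, false_iff, not_and]
    intro h0
    exact absurd h (h0 b).ne'
  · have hpos : (0 : ℚ) < (Module.finrank ℂ (rootEigenspace k v b) : ℚ) := by
      exact_mod_cast Nat.pos_of_ne_zero h
    rw [Nat.cast_le, Nat.ceil_le, div_le_iff₀ hpos]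
    constructor
    · intro h1
      refine ⟨fun j => (Nat.pos_of_ne_zero h).trans_le (hge j), fun i j => ?_⟩
      exact (hle i).trans ((by exact_mod_cast h1 : _ ≤ N * _).trans
        (Nat.mul_le_mul_left N (hge j)))
    · rintro ⟨-, h1⟩
      exact_mod_cast h1 a b

theorem matrixSpread_ne_zero {k : ℕ} [NeZero k] {n : ℕ} (v : Matrix (Fin n) (Fin n) ℂ) :
    matrixSpread k v ≠ 0 := by
  intro h
  obtain ⟨h1, h2⟩ := (matrixSpread_le_natCast_iff (k := k) (v := v) (N := 0)).1 (by simp [h])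
  have := h1 0
  have := h2 0 0
  omega

/-! ### Ranks of invertible sums -/

theorem finrank_iSup_le_sum {K V ι : Type*} [Field K] [AddCommGroup V] [Module K V]
    [FiniteDimensional K V] [Fintype ι] (S : ι → Submodule K V) :
    Module.finrank K ↥(⨆ i, S i) ≤ ∑ i, Module.finrank K (S i) := by
  classical
  suffices h : ∀ s : Finset ι, Module.finrank K ↥(⨆ i ∈ s, S i) ≤ ∑ i ∈ s, Module.finrank K (S i) by
    rw [show ⨆ i, S i = ⨆ i ∈ Finset.univ, S i by simp]
    exact h Finset.univ
  intro s
  induction s using Finset.induction_on with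
  | empty => simp
  | insert a s ha ih =>
    rw [Finset.iSup_insert, Finset.sum_insert ha]
    exact (Submodule.finrank_add_le_finrank_add_finrank _ _).trans (by omega)

/-- If a sum of endomorphisms is injective and each of them has rank at most `d` on `W`, then the
dimension of `W` is at most `d` times the number of endomorphisms. -/
theorem finrank_le_card_mul_of_injective_sum {K V ι : Type*} [Field K] [AddCommGroup V]
    [Module K V] [FiniteDimensional K V] [Fintype ι] (S : ι → Module.End K V)
    (hS : Function.Injective (∑ i, S i : Module.End K V)) (W : Submodule K V) (d : ℕ)
    (hd : ∀ i, Module.finrank K (W.map (S i)) ≤ d) :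
    Module.finrank K W ≤ Fintype.card ι * d := by
  rw [(Submodule.equivMapOfInjective _ hS W).finrank_eq]
  have hle : W.map (∑ i, S i : Module.End K V) ≤ ⨆ i, W.map (S i) := by
    rintro _ ⟨ξ, hξ, rfl⟩
    rw [LinearMap.sum_apply]
    exact Submodule.sum_mem _ fun i _ =>
      Submodule.mem_iSup_of_mem i (Submodule.mem_map_of_mem hξ)
  calc _ ≤ _ := Submodule.finrank_mono hle
    _ ≤ _ := finrank_iSup_le_sum _
    _ ≤ ∑ _i : ι, d := Finset.sum_le_sum fun i _ => hd i
    _ = _ := by simp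

/-! ### The lower bound -/

/-- The function `√t` of `C_0((0,1])`. -/
noncomputable def coneSqrt : ConeAlgebra where
  toFun := fun r => ((√(r : ℝ) : ℝ) : ℂ)
  continuous_toFun := by fun_prop
  map_zero' := by simp

theorem star_coneSqrt_mul_self : star coneSqrt * coneSqrt = coneCoordinate := by
  ext r
  change star ((√(r : ℝ) : ℝ) : ℂ) * ((√(r : ℝ) : ℝ) : ℂ) = ((r : ℝ) : ℂ)
  rw [Complex.star_def, Complex.conj_ofReal, ← Complex.ofReal_mul, Real.mul_self_sqrt r.2.1]

/-- The element `√t ⊗ χ` of `C_0((0,1]) ⊗ C(ℤ/k)`, where `χ` is the character `h ↦ e^{2πimh/k}`. -/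
noncomputable def coneCharacter (k : ℕ) [NeZero k] (m : ZMod k) : EquivariantCone k :=
  fun h => ZMod.stdAddChar (N := k) (m * h) • coneSqrt

theorem star_coneCharacter_mul_self (k : ℕ) [NeZero k] (m : ZMod k) :
    star (coneCharacter k m) * coneCharacter k m = fun _ => coneCoordinate := by
  funext h
  simp only [coneCharacter, Pi.mul_apply, Pi.star_apply, star_smul, smul_mul_smul_comm,
    star_coneSqrt_mul_self]
  rw [Complex.star_def, ← AddChar.map_neg_eq_conj, ← AddChar.map_add_eq_mul]
  simp

theorem coneCharacter_translate (k : ℕ) [NeZero k] (m : ZMod k) :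
    (fun h => coneCharacter k m (h + 1)) = ZMod.stdAddChar (N := k) m • coneCharacter k m := by
  funext h
  simp only [coneCharacter, Pi.smul_apply, smul_smul, ← AddChar.map_add_eq_mul]
  congr 2
  ring

/-- Equivariant maps whose values at `t ⊗ 1` have an invertible sum bound the spread. The value
`c` at `√t ⊗ χ`, for a character `χ` of `ℤ/k`, shifts the eigenspaces of `v`, and `c* c` is the
value at `t ⊗ 1`; so the rank of the latter on any eigenspace is at most the dimension of any
other one. -/
theorem matrixSpread_le_of_equivariant {k n N : ℕ} [NeZero k] (hn : 0 < n)
    {v : Matrix (Fin n) (Fin n) ℂ} (hv : v ∈ unitary (Matrix (Fin n) (Fin n) ℂ)) (hvk : v ^ k = 1)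
    (ψ : Fin (N + 1) → (EquivariantCone k →⋆ₙₐ[ℂ] Matrix (Fin n) (Fin n) ℂ))
    (hψ : ∀ j (f : EquivariantCone k), ψ j (fun h => f (h + 1)) = v * ψ j f * star v)
    (hu : IsUnit (∑ j, ψ j (fun _ => coneCoordinate))) :
    matrixSpread k v ≤ ((N + 1 : ℕ) : ℕ∞) := by
  have hshift : ∀ j (m : ZMod k), v * ψ j (coneCharacter k m) =
      ZMod.stdAddChar (N := k) m • (ψ j (coneCharacter k m) * v) := by
    intro j m
    have h := hψ j (coneCharacter k m)
    rw [coneCharacter_translate, map_smul] at h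
    rw [← smul_mul_assoc, h, mul_assoc, Unitary.star_mul_self_of_mem hv, mul_one]
  have hrank : ∀ (l : Fin (N + 1)) (i j : Fin k), Module.finrank ℂ
      ((rootEigenspace k v i).map (Matrix.toLin' (ψ l (fun _ => coneCoordinate)))) ≤
      Module.finrank ℂ (rootEigenspace k v j) := by
    intro l i j
    let m : ZMod k := ((j : ℕ) : ZMod k) - ((i : ℕ) : ZMod k)
    rw [← star_coneCharacter_mul_self k m, map_mul, Matrix.toLin'_mul, Submodule.map_comp]
    refine (Submodule.finrank_map_le _ _).trans (Submodule.finrank_mono ?_)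
    rintro _ ⟨ξ, hξ, rfl⟩
    have hξ' := mem_rootEigenspace.1 hξ
    rw [Matrix.toLin'_apply, mem_rootEigenspace, Matrix.mulVec_mulVec, hshift, Matrix.smul_mulVec,
      ← Matrix.mulVec_mulVec, hξ', Matrix.mulVec_smul, smul_smul, ← AddChar.map_add_eq_mul]
    simp [m]
  have hle : ∀ i j, Module.finrank ℂ (rootEigenspace k v i) ≤
      (N + 1) * Module.finrank ℂ (rootEigenspace k v j) := by
    intro i j
    have h := finrank_le_card_mul_of_injective_sum
      (fun l => Matrix.toLin' (ψ l (fun _ => coneCoordinate))) ?_ (rootEigenspace k v i)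
      (Module.finrank ℂ (rootEigenspace k v j)) (fun l => hrank l i j)
    · simpa using h
    · rw [← map_sum]
      exact Matrix.mulVec_injective_iff_isUnit.2 hu
  refine matrixSpread_le_natCast_iff.2 ⟨fun j => ?_, hle⟩
  by_contra hj
  -- One empty eigenspace makes all of them empty, but together they span `ℂ^n`.
  have hbot : ∀ i, rootEigenspace k v i = ⊥ := fun i => by
    rw [← Submodule.finrank_eq_zero (R := ℂ)]
    have := hle i j
    rw [Nat.eq_zero_of_not_pos hj] at this
    omega
  have htop := iSup_rootEigenspace_eq_top hvk
  simp only [hbot, iSup_bot] at htop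
  have : Nonempty (Fin n) := ⟨⟨0, hn⟩⟩
  exact bot_ne_top htop

namespace MatrixBundle

variable {X : Type u} [TopologicalSpace X] (M : MatrixBundle.{u, v} X)

/-- Evaluation of sections at a point. -/
def evalFiber (x : X) : M.sections →⋆ₐ[ℂ] M.Fiber x where
  toFun s := s.1 x
  map_one' := rfl
  map_mul' _ _ := rfl
  map_zero' := rfl
  map_add' _ _ := rfl
  commutes' _ := rfl
  map_star' _ := rfl

theorem exists_fiber_equiv (x : X) :
    ∃ n : ℕ, 0 < n ∧ Nonempty (M.Fiber x ≃⋆ₐ[ℂ] Matrix (Fin n) (Fin n) ℂ) := by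
  obtain ⟨n, hn, e, hx, he⟩ := M.locallyTrivial x
  obtain ⟨φ, -⟩ := he x hx
  exact ⟨n, hn, ⟨φ⟩⟩

theorem pos_of_fiber_equiv {x : X} {n : ℕ} (φ : M.Fiber x ≃⋆ₐ[ℂ] Matrix (Fin n) (Fin n) ℂ) :
    0 < n := by
  obtain ⟨m, hm, ⟨χ⟩⟩ := M.exists_fiber_equiv x
  by_contra h
  obtain rfl : n = 0 := by omega
  have : Nonempty (Fin m) := ⟨⟨0, hm⟩⟩
  have h01 : (0 : Matrix (Fin m) (Fin m) ℂ) = 1 := by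
    rw [← map_zero χ, ← map_one χ]
    exact congrArg χ (φ.injective (Subsingleton.elim _ _))
  exact zero_ne_one h01

namespace CyclicAction

variable {M} {k : ℕ} (T : M.CyclicAction k)

theorem quotientSpread_le_iff {q : ℕ∞} : T.quotientSpread ≤ q ↔
    ∀ (x : X) (n : ℕ) (φ : M.Fiber x ≃⋆ₐ[ℂ] Matrix (Fin n) (Fin n) ℂ)
      (v : Matrix (Fin n) (Fin n) ℂ), T.IsFiberGenerator x φ v → matrixSpread k v ≤ q := by
  simp only [quotientSpread, iSup_le_iff, fiberSpread, sSup_le_iff]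
  constructor
  · intro h x n φ v hv
    exact h x _ ⟨n, φ, v, hv, rfl⟩
  · rintro h x _ ⟨n, φ, v, hv, rfl⟩
    exact h x n φ v hv

theorem quotientSpread_le_weakLTDim_add_one [NeZero k] :
    T.quotientSpread ≤ weakLTDim T.onSections + 1 := by
  by_cases htop : weakLTDim T.onSections = ⊤
  · simp [htop]
  have hne : {m : ℕ∞ | ∃ n : ℕ, m = n ∧
      ∃ ρ : Fin (n + 1) → (EquivariantCone k →⋆ₙₐ[ℂ] M.sections),
        (∀ j (g : ZMod k) (f : EquivariantCone k),
          ρ j (fun h => f (h + g)) = T.onSections (Multiplicative.ofAdd g) (ρ j f)) ∧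
        IsUnit (∑ j, ρ j (fun _ => coneCoordinate))}.Nonempty := by
    by_contra h
    exact htop (by rw [weakLTDim, Set.not_nonempty_iff_eq_empty.1 h, sInf_empty])
  obtain ⟨N, hN, ρ, hρ, hu⟩ := csInf_mem hne
  rw [weakLTDim, hN, quotientSpread_le_iff]
  rintro x n φ v ⟨hv, hvk, hact⟩
  let ψ : M.sections →⋆ₐ[ℂ] Matrix (Fin n) (Fin n) ℂ :=
    (φ : M.Fiber x →⋆ₐ[ℂ] Matrix (Fin n) (Fin n) ℂ).comp (M.evalFiber x)
  refine (matrixSpread_le_of_equivariant (M.pos_of_fiber_equiv φ) hv hvk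
    (fun j => (ψ : M.sections →⋆ₙₐ[ℂ] Matrix (Fin n) (Fin n) ℂ).comp (ρ j)) ?_ ?_).trans
    (by push_cast; rfl)
  · intro j f
    change φ ((ρ j (fun h => f (h + 1))).1 x) = _
    rw [hρ]
    exact hact _
  · have := hu.map ψ
    rw [map_sum] at this
    exact this

end CyclicAction

end MatrixBundle

/-! ### Existence of a unitary generator on each fibre -/

/-- Every *-automorphism of `M_n(ℂ)` is conjugation by a unitary. -/
theorem exists_unitary_conj {n : ℕ}
    (θ : Matrix (Fin n) (Fin n) ℂ ≃⋆ₐ[ℂ] Matrix (Fin n) (Fin n) ℂ) :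
    ∃ w ∈ unitary (Matrix (Fin n) (Fin n) ℂ), ∀ a, θ a = w * a * star w := by
  let τ := Matrix.toEuclideanCLM (n := Fin n) (𝕜 := ℂ)
  let f := (τ.symm.trans θ).trans τ
  have hf : Continuous f :=
    LinearMap.continuous_of_finiteDimensional (f.toAlgEquiv.toLinearMap)
  obtain ⟨U, hU⟩ := StarAlgEquiv.eq_linearIsometryEquivConjStarAlgEquiv f hf
  rw [← Unitary.conjStarAlgAut_symm_unitaryLinearIsometryEquiv] at hU
  let V := EuclideanSpace ℂ (Fin n)
  let W : V →L[ℂ] V := (Unitary.linearIsometryEquiv.symm U : unitary (V →L[ℂ] V))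
  obtain ⟨hW1, hW2⟩ := Unitary.mem_iff.1 (Unitary.linearIsometryEquiv.symm U).2
  have hstar : star (τ.symm W) = τ.symm (star W) := (map_star τ.symm W).symm
  refine ⟨τ.symm W, Unitary.mem_iff.2 ⟨?_, ?_⟩, fun a => EquivLike.injective τ ?_⟩
  · rw [hstar, ← map_mul, hW1, map_one]
  · rw [hstar, ← map_mul, hW2, map_one]
  · have h : f (τ a) = W * τ a * star W := by
      rw [hU]; rfl
    rw [hstar, map_mul, map_mul, StarAlgEquiv.apply_symm_apply, StarAlgEquiv.apply_symm_apply, ← h]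
    simp [f]

/-- A *-automorphism of `M_n(ℂ)` of order dividing `k` is conjugation by a unitary `v` with
`v^k = 1`: rescale an implementing unitary by a `k`-th root of its (scalar) `k`-th power. -/
theorem exists_unitary_conj_pow_eq_one {k n : ℕ} (hk : k ≠ 0) (hn : 0 < n)
    (θ : Matrix (Fin n) (Fin n) ℂ ≃⋆ₐ[ℂ] Matrix (Fin n) (Fin n) ℂ) (hθ : ∀ a, θ^[k] a = a) :
    ∃ v ∈ unitary (Matrix (Fin n) (Fin n) ℂ), v ^ k = 1 ∧ ∀ a, θ a = v * a * star v := by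
  have : Nonempty (Fin n) := ⟨⟨0, hn⟩⟩
  obtain ⟨w, hw, hwθ⟩ := exists_unitary_conj θ
  have hiter : ∀ (m : ℕ) a, θ^[m] a = w ^ m * a * star (w ^ m) := by
    intro m a
    induction m with
    | zero => simp
    | succ m ih =>
      rw [Function.iterate_succ_apply', ih, hwθ, pow_succ', star_mul]
      simp only [mul_assoc]
  have hwk : w ^ k ∈ unitary (Matrix (Fin n) (Fin n) ℂ) := pow_mem hw k
  have hcentral : w ^ k ∈ Subalgebra.center ℂ (Matrix (Fin n) (Fin n) ℂ) := by
    rw [Subalgebra.mem_center_iff]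
    intro a
    have h := hiter k a
    rw [hθ] at h
    calc a * w ^ k = w ^ k * a * (star (w ^ k) * w ^ k) := by rw [← mul_assoc, ← h]
      _ = w ^ k * a := by rw [Unitary.star_mul_self_of_mem hwk, mul_one]
  rw [Algebra.IsCentral.center_eq_bot, Algebra.mem_bot] at hcentral
  obtain ⟨c, hc⟩ := hcentral
  rw [Algebra.algebraMap_eq_smul_one] at hc
  have hcc : star c * c = 1 := by
    have h := Unitary.star_mul_self_of_mem hwk
    rw [← hc, star_smul, star_one, smul_mul_smul_comm, one_mul] at h
    have h' := congrFun (congrFun h ⟨0, hn⟩) ⟨0, hn⟩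
    simpa using h'
  obtain ⟨l, hl⟩ := IsAlgClosed.exists_pow_nat_eq (star c) (Nat.pos_of_ne_zero hk)
  have hl1 : star l * l = 1 := by
    have h1 : ‖c‖ = 1 := by
      have h2 := congrArg norm hcc
      rw [norm_mul, norm_star, norm_one] at h2
      nlinarith [norm_nonneg c]
    have h2 : ‖l‖ ^ k = 1 := by rw [← norm_pow, hl, norm_star, h1]
    have h3 : ‖l‖ = 1 := (pow_eq_one_iff_of_nonneg (norm_nonneg l) hk).1 h2
    rw [Complex.star_def, Complex.conj_mul', h3]
    simp
  have hl2 : l * star l = 1 := by rw [mul_comm, hl1]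
  refine ⟨l • w, Unitary.mem_iff.2 ⟨?_, ?_⟩, ?_, fun a => ?_⟩
  · rw [star_smul, smul_mul_smul_comm, hl1, Unitary.star_mul_self_of_mem hw, one_smul]
  · rw [star_smul, smul_mul_smul_comm, hl2, Unitary.mul_star_self_of_mem hw, one_smul]
  · rw [smul_pow, hl, ← hc, smul_smul, hcc, one_smul]
  · rw [star_smul, smul_mul_assoc, smul_mul_smul_comm, hl2, one_smul, hwθ]

namespace MatrixBundle

namespace CyclicAction

variable {X : Type u} [TopologicalSpace X] {M : MatrixBundle.{u, v} X} {k : ℕ}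
  (T : M.CyclicAction k)

theorem act_iterate (x : X) (m : ℕ) (a : M.Fiber x) :
    (T.act x (Multiplicative.ofAdd 1))^[m] a = T.act x (Multiplicative.ofAdd (m : ZMod k)) a := by
  induction m with
  | zero => simp
  | succ m ih =>
    rw [Function.iterate_succ_apply', ih, Nat.cast_succ, add_comm, ofAdd_add, map_mul]
    rfl

theorem exists_isFiberGenerator [NeZero k] (x : X) {n : ℕ}
    (φ : M.Fiber x ≃⋆ₐ[ℂ] Matrix (Fin n) (Fin n) ℂ) :
    ∃ v, T.IsFiberGenerator x φ v := by
  let θ := (φ.symm.trans (T.act x (Multiplicative.ofAdd 1))).trans φ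
  have hiter : ∀ (m : ℕ) a, θ^[m] (φ a) = φ ((T.act x (Multiplicative.ofAdd 1))^[m] a) := by
    intro m a
    induction m with
    | zero => rfl
    | succ m ih =>
      rw [Function.iterate_succ_apply', Function.iterate_succ_apply', ih]
      simp [θ]
  have hθ : ∀ a, θ^[k] a = a := by
    intro a
    obtain ⟨b, rfl⟩ : ∃ b, φ b = a := ⟨φ.symm a, φ.apply_symm_apply a⟩
    rw [hiter, act_iterate, ZMod.natCast_self, ofAdd_zero, map_one]
    rfl
  obtain ⟨v, hv, hvk, h⟩ :=
    exists_unitary_conj_pow_eq_one (NeZero.ne k) (M.pos_of_fiber_equiv φ) θ hθ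
  refine ⟨v, hv, hvk, fun a => ?_⟩
  rw [← h]
  simp [θ]

theorem quotientSpread_ne_zero [NeZero k] [Nonempty X] : T.quotientSpread ≠ 0 := by
  intro h
  obtain ⟨x⟩ := ‹Nonempty X›
  obtain ⟨n, -, ⟨φ⟩⟩ := M.exists_fiber_equiv x
  obtain ⟨v, hv⟩ := T.exists_isFiberGenerator x φ
  exact matrixSpread_ne_zero (k := k) v
    (le_antisymm (T.quotientSpread_le_iff.1 h.le x n φ v hv) bot_le)

end CyclicAction

end MatrixBundle

/-! ### Positive combinations of projections -/

theorem dotProduct_star_eq_sum_norm_sq {n : Type*} [Fintype n] (ξ : n → ℂ) :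
    star ξ ⬝ᵥ ξ = ((∑ i, ‖ξ i‖ ^ 2 : ℝ) : ℂ) := by
  simp [dotProduct, Complex.conj_mul']

/-- A nonnegative combination of self-adjoint projections is invertible as soon as the projections
that have positive coefficients have an invertible sum. -/
theorem isUnit_sum_smul_of_projections {n ι : Type*} [Fintype n] [DecidableEq n] [Fintype ι]
    (P : ι → Matrix n n ℂ) (hP : ∀ i, IsStarProjection (P i)) (c : ι → ℝ) (hc : ∀ i, 0 ≤ c i)
    (S : Finset ι) (hS : ∀ i ∈ S, 0 < c i) (hu : IsUnit (∑ i ∈ S, P i)) :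
    IsUnit (∑ i, (c i : ℂ) • P i) := by
  rw [← Matrix.mulVec_injective_iff_isUnit]
  change Function.Injective (Matrix.mulVecLin _)
  rw [injective_iff_map_eq_zero]
  intro ξ hξ
  rw [Matrix.mulVecLin_apply] at hξ
  have hquad : ∀ i, star ξ ⬝ᵥ (P i).mulVec ξ = ((∑ l, ‖(P i).mulVec ξ l‖ ^ 2 : ℝ) : ℂ) := by
    intro i
    have hsa : (P i).conjTranspose = P i := (hP i).isSelfAdjoint
    rw [← dotProduct_star_eq_sum_norm_sq, Matrix.star_mulVec, hsa, ← Matrix.dotProduct_mulVec,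
      Matrix.mulVec_mulVec, (hP i).isIdempotentElem.eq]
  have hzero : ∑ i, c i * ∑ l, ‖(P i).mulVec ξ l‖ ^ 2 = 0 := by
    have h : star ξ ⬝ᵥ (∑ i, (c i : ℂ) • P i).mulVec ξ = 0 := by rw [hξ, dotProduct_zero]
    simp only [Matrix.sum_mulVec, Matrix.smul_mulVec, dotProduct_sum, dotProduct_smul, hquad,
      smul_eq_mul] at h
    exact_mod_cast h
  have hker : ∀ i ∈ S, (P i).mulVec ξ = 0 := by
    intro i hi
    have h := (Finset.sum_eq_zero_iff_of_nonneg
      (fun i _ => mul_nonneg (hc i) (Finset.sum_nonneg fun l _ => sq_nonneg _))).1 hzero i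
      (Finset.mem_univ i)
    have h' := (mul_eq_zero.1 h).resolve_left (hS i hi).ne'
    funext l
    have := (Finset.sum_eq_zero_iff_of_nonneg (fun l _ => sq_nonneg _)).1 h' l (Finset.mem_univ l)
    simpa using this
  refine Matrix.mulVec_injective_iff_isUnit.2 hu ?_
  rw [Matrix.sum_mulVec, Finset.sum_eq_zero hker, Matrix.mulVec_zero]

/-! ### Regular subrepresentations of a diagonal matrix -/

/-- A system of projections in a *-algebra `A` that an endomorphism `θ` permutes like the minimal
projections of `C(ℤ/k)` under translation: a non-unital equivariant *-homomorphism from `C(ℤ/k)`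
to `A`. -/
structure IsCyclicSystem {A : Type*} [NonUnitalRing A] [StarRing A] {k : ℕ} (θ : A → A)
    (P : ZMod k → A) : Prop where
  star_eq : ∀ h, star (P h) = P h
  mul_eq : ∀ h h', P h * P h' = if h = h' then P h else 0
  map_eq : ∀ h, θ (P h) = P (h - 1)

theorem IsCyclicSystem.isStarProjection {A : Type*} [NonUnitalRing A] [StarRing A] {k : ℕ}
    {θ : A → A} {P : ZMod k → A} (hP : IsCyclicSystem θ P) (h : ZMod k) :
    IsStarProjection (P h) :=
  ⟨by rw [IsIdempotentElem, hP.mul_eq, if_pos rfl], hP.star_eq h⟩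

section Fourier

variable {k : ℕ} [NeZero k] {d : Fin k → ℕ} {D : ℕ}

/-- The diagonal matrix with eigenvalue `exp(2πi/k)^j` of multiplicity `d j`. -/
noncomputable def rootDiagonal (k : ℕ) [NeZero k] (d : Fin k → ℕ) :
    Matrix ((j : Fin k) × Fin (d j)) ((j : Fin k) × Fin (d j)) ℂ :=
  Matrix.diagonal fun p => ZMod.stdAddChar (N := k) ((p.1 : ℕ) : ZMod k)

/-- A choice `σ` of `D` basis vectors in each eigenspace of `rootDiagonal k d` spans a multiple of
the regular representation of `ℤ/k`. The columns of this matrix are the vectors of that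
representation which are concentrated at the group element `h`. -/
noncomputable def fourierColumns (σ : ∀ j, Fin D → Fin (d j)) (h : ZMod k) :
    Matrix ((j : Fin k) × Fin (d j)) (Fin D) ℂ :=
  Matrix.of fun p a => if p.2 = σ p.1 a then
    ((√(k : ℝ) : ℝ) : ℂ)⁻¹ * ZMod.stdAddChar (N := k) (-(((p.1 : ℕ) : ZMod k) * h)) else 0

theorem inv_sqrt_mul_inv_sqrt (k : ℕ) :
    ((√(k : ℝ) : ℝ) : ℂ)⁻¹ * ((√(k : ℝ) : ℝ) : ℂ)⁻¹ = (k : ℂ)⁻¹ := by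
  rw [← mul_inv, ← Complex.ofReal_mul, Real.mul_self_sqrt (Nat.cast_nonneg k),
    Complex.ofReal_natCast]

theorem star_stdAddChar (x : ZMod k) :
    star (ZMod.stdAddChar (N := k) x) = ZMod.stdAddChar (N := k) (-x) := by
  rw [AddChar.map_neg_eq_conj, Complex.star_def]

theorem conjTranspose_fourierColumns_mul (σ : ∀ j, Fin D → Fin (d j))
    (hσ : ∀ j, Function.Injective (σ j)) (h h' : ZMod k) :
    (fourierColumns σ h).conjTranspose * fourierColumns σ h' = if h = h' then 1 else 0 := by
  ext a a'
  have hterm : ∀ j : Fin k, ∑ c : Fin (d j), star (fourierColumns σ h ⟨j, c⟩ a) *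
      fourierColumns σ h' ⟨j, c⟩ a' = if a = a' then (k : ℂ)⁻¹ *
        ZMod.stdAddChar (N := k) (((j : ℕ) : ZMod k) * (h - h')) else 0 := by
    intro j
    rw [Finset.sum_eq_single (σ j a)]
    · by_cases haa : a = a'
      · subst haa
        simp only [fourierColumns, Matrix.of_apply, if_true, star_mul', star_inv₀, Complex.star_def,
          Complex.conj_ofReal]
        rw [mul_mul_mul_comm, inv_sqrt_mul_inv_sqrt, ← Complex.star_def, star_stdAddChar,
          ← AddChar.map_add_eq_mul]
        congr 2
        ring
      · have : σ j a ≠ σ j a' := fun hh => haa (hσ j hh)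
        simp [fourierColumns, this, haa]
    · intro c _ hc
      simp [fourierColumns, hc]
    · simp
  rw [Matrix.mul_apply, Fintype.sum_sigma]
  simp only [Matrix.conjTranspose_apply, hterm]
  by_cases haa : a = a'
  · subst haa
    simp only [if_true, ← Finset.mul_sum]
    rw [(natCast_fin_bijective k).sum_comp
      (fun x : ZMod k => ZMod.stdAddChar (N := k) (x * (h - h'))), sum_stdAddChar_mul]
    have hk : (k : ℂ) ≠ 0 := by exact_mod_cast NeZero.ne k
    by_cases hh : h = h'
    · simp [hh, hk]
    · simp [hh, sub_eq_zero]
  · simp only [haa, if_false, Finset.sum_const_zero]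
    split_ifs <;> simp [haa]

theorem rootDiagonal_mul_fourierColumns (σ : ∀ j, Fin D → Fin (d j)) (h : ZMod k) :
    rootDiagonal k d * fourierColumns σ h = fourierColumns σ (h - 1) := by
  ext p a
  rw [rootDiagonal, Matrix.diagonal_mul]
  simp only [fourierColumns, Matrix.of_apply, mul_ite, mul_zero]
  split_ifs with hp
  · rw [mul_left_comm, ← AddChar.map_add_eq_mul]
    congr 2
    ring
  · rfl

/-- The projection onto the span of the `fourierColumns`. -/
noncomputable def fourierProjection (σ : ∀ j, Fin D → Fin (d j)) (h : ZMod k) :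
    Matrix ((j : Fin k) × Fin (d j)) ((j : Fin k) × Fin (d j)) ℂ :=
  fourierColumns σ h * (fourierColumns σ h).conjTranspose

theorem isCyclicSystem_fourierProjection (σ : ∀ j, Fin D → Fin (d j))
    (hσ : ∀ j, Function.Injective (σ j)) :
    IsCyclicSystem (fun a => rootDiagonal k d * a * star (rootDiagonal k d))
      (fourierProjection (k := k) σ) where
  star_eq h := by
    rw [fourierProjection, Matrix.star_eq_conjTranspose, Matrix.conjTranspose_mul,
      Matrix.conjTranspose_conjTranspose]
  mul_eq h h' := by
    rw [fourierProjection, fourierProjection, Matrix.mul_assoc,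
      ← Matrix.mul_assoc (fourierColumns σ h).conjTranspose, conjTranspose_fourierColumns_mul σ hσ]
    split_ifs with hh
    · subst hh; simp
    · simp
  map_eq h := by
    rw [fourierProjection, fourierProjection, Matrix.star_eq_conjTranspose, ← Matrix.mul_assoc,
      rootDiagonal_mul_fourierColumns, Matrix.mul_assoc, ← Matrix.conjTranspose_mul,
      rootDiagonal_mul_fourierColumns]

theorem sum_fourierProjection (σ : ∀ j, Fin D → Fin (d j)) :
    ∑ h, fourierProjection (k := k) σ h =
      Matrix.diagonal fun p => ((Finset.univ.filter fun a => p.2 = σ p.1 a).card : ℂ) := by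
  have hk : (k : ℂ) ≠ 0 := by exact_mod_cast NeZero.ne k
  ext p p'
  simp only [Matrix.sum_apply, fourierProjection, Matrix.mul_apply, Matrix.conjTranspose_apply]
  rw [Finset.sum_comm]
  have hterm : ∀ a : Fin D, ∑ h : ZMod k, fourierColumns σ h p a * star (fourierColumns σ h p' a) =
      if p = p' ∧ p.2 = σ p.1 a then 1 else 0 := by
    intro a
    by_cases h1 : p.2 = σ p.1 a
    swap
    · simp [fourierColumns, h1]
    by_cases h2 : p'.2 = σ p'.1 a
    swap
    · have : ¬ p = p' := by rintro rfl; exact h2 h1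
      simp [fourierColumns, h2, this]
    simp only [fourierColumns, Matrix.of_apply, h1, h2, if_true, star_mul', star_inv₀,
      Complex.star_def, Complex.conj_ofReal]
    have : ∀ h : ZMod k, ((√(k : ℝ) : ℝ) : ℂ)⁻¹ *
        ZMod.stdAddChar (N := k) (-(((p.1 : ℕ) : ZMod k) * h)) * (((√(k : ℝ) : ℝ) : ℂ)⁻¹ *
          (starRingEnd ℂ) (ZMod.stdAddChar (N := k) (-(((p'.1 : ℕ) : ZMod k) * h)))) =
        (k : ℂ)⁻¹ * ZMod.stdAddChar (N := k)
          (h * (((p'.1 : ℕ) : ZMod k) - ((p.1 : ℕ) : ZMod k))) := by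
      intro h
      rw [mul_mul_mul_comm, inv_sqrt_mul_inv_sqrt, ← Complex.star_def, star_stdAddChar,
        ← AddChar.map_add_eq_mul]
      congr 2
      ring
    simp only [this, ← Finset.mul_sum, sum_stdAddChar_mul, sub_eq_zero]
    by_cases h3 : p = p'
    · subst h3; simp [hk]
    · have h4 : ((p'.1 : ℕ) : ZMod k) ≠ ((p.1 : ℕ) : ZMod k) := by
        intro hh
        have h5 : p'.1 = p.1 := (natCast_fin_bijective k).1 hh
        apply h3
        obtain ⟨j, c⟩ := p
        obtain ⟨j', c'⟩ := p'
        obtain rfl : j' = j := h5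
        simp only at h1 h2
        rw [h1, h2]
      simp [h3, h4]
  simp only [hterm]
  by_cases hp : p = p'
  · subst hp
    simp [Finset.sum_boole]
  · simp [hp]

/-- If all the multiplicities lie between `D` and `q * D`, then `q` multiples of the regular
representation, of multiplicity `D` each, cover the whole space. -/
theorem exists_cyclicSystems_rootDiagonal (d : Fin k → ℕ) (D q : ℕ) (hD : 0 < D)
    (hle : ∀ j, D ≤ d j) (hge : ∀ j, d j ≤ q * D) :
    ∃ P : Fin q → ZMod k → Matrix ((j : Fin k) × Fin (d j)) ((j : Fin k) × Fin (d j)) ℂ,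
      (∀ l, IsCyclicSystem (fun a => rootDiagonal k d * a * star (rootDiagonal k d)) (P l)) ∧
      IsUnit (∑ l, ∑ h, P l h) := by
  -- The `l`-th choice takes `D` consecutive basis vectors from position `l * D` on, or the last
  -- `D` ones when fewer are left.
  let σ : Fin q → ∀ j, Fin D → Fin (d j) := fun l j a =>
    ⟨min ((l : ℕ) * D) (d j - D) + a, by have := hle j; have := a.2; omega⟩
  refine ⟨fun l => fourierProjection (σ l), fun l => isCyclicSystem_fourierProjection _ ?_, ?_⟩
  · intro j a a' haa
    have := congrArg Fin.val haa
    simp only [σ] at this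
    exact Fin.ext (by omega)
  · have hcover : ∀ p : (j : Fin k) × Fin (d j), ∃ l a, p.2 = σ l p.1 a := by
      rintro ⟨j, c⟩
      have hj := hge j
      have hj' := hle j
      have hc := c.2
      have hdiv := Nat.div_add_mod' (c : ℕ) D
      have hmod := Nat.mod_lt (c : ℕ) hD
      have hlt : (c : ℕ) / D < q := (Nat.div_lt_iff_lt_mul hD).2 (hc.trans_le hj)
      by_cases h : (c : ℕ) / D * D ≤ d j - D
      · refine ⟨⟨(c : ℕ) / D, hlt⟩, ⟨(c : ℕ) % D, hmod⟩, Fin.ext ?_⟩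
        simp only [σ]
        omega
      · refine ⟨⟨(c : ℕ) / D, hlt⟩, ⟨(c : ℕ) - (d j - D), by omega⟩, Fin.ext ?_⟩
        simp only [σ]
        omega
    simp only [sum_fourierProjection]
    have hsum : ∑ l, Matrix.diagonal (fun p : (j : Fin k) × Fin (d j) =>
        ((Finset.univ.filter fun a => p.2 = σ l p.1 a).card : ℂ)) =
        Matrix.diagonal (fun p =>
          ∑ l, ((Finset.univ.filter fun a => p.2 = σ l p.1 a).card : ℂ)) := by
      rw [← Finset.sum_fn]
      exact (map_sum (Matrix.diagonalAddMonoidHom ((j : Fin k) × Fin (d j)) ℂ) _ _).symm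
    rw [hsum, Matrix.isUnit_diagonal, Pi.isUnit_iff]
    intro p
    obtain ⟨l, a, ha⟩ := hcover p
    rw [isUnit_iff_ne_zero]
    norm_cast
    refine (Finset.sum_pos' (fun _ _ => Nat.zero_le _) ⟨l, Finset.mem_univ _, ?_⟩).ne'
    exact Finset.card_pos.2 ⟨a, by simpa using ha⟩

end Fourier

/-! ### Continuous orthonormal eigenframes -/

theorem continuousOn_gramSchmidt {X E ι : Type*} [TopologicalSpace X] [NormedAddCommGroup E]
    [InnerProductSpace ℂ E] [LinearOrder ι] [LocallyFiniteOrderBot ι] [WellFoundedLT ι]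
    {V : Set X} {b : ι → X → E} (hb : ∀ i, ContinuousOn (b i) V)
    (hli : ∀ x ∈ V, LinearIndependent ℂ (fun i => b i x)) (i : ι) :
    ContinuousOn (fun x => InnerProductSpace.gramSchmidt ℂ (fun i => b i x) i) V := by
  induction i using WellFoundedLT.induction with
  | ind i ih =>
    have heq : (fun x => InnerProductSpace.gramSchmidt ℂ (fun i => b i x) i) = fun x =>
        b i x - ∑ l ∈ Finset.Iio i, (inner ℂ (InnerProductSpace.gramSchmidt ℂ (fun i => b i x) l)
          (b i x) / ((‖InnerProductSpace.gramSchmidt ℂ (fun i => b i x) l‖ ^ 2 : ℝ) : ℂ)) •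
            InnerProductSpace.gramSchmidt ℂ (fun i => b i x) l := by
      funext x
      rw [InnerProductSpace.gramSchmidt_def]
      congr 1
      exact Finset.sum_congr rfl fun l _ => Submodule.starProjection_singleton ℂ _
    rw [heq]
    refine (hb i).sub (continuousOn_finsetSum _ fun l hl => ?_)
    have hl' := ih l (Finset.mem_Iio.1 hl)
    refine ContinuousOn.smul (ContinuousOn.div (hl'.inner (𝕜 := ℂ) (hb i)) ?_ ?_) hl'
    · exact Complex.continuous_ofReal.comp_continuousOn (hl'.norm.pow 2)
    · intro x hx
      have := InnerProductSpace.gramSchmidt_ne_zero (𝕜 := ℂ) l (hli x hx)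
      simpa using this

theorem continuousOn_gramSchmidtNormed {X E ι : Type*} [TopologicalSpace X] [NormedAddCommGroup E]
    [InnerProductSpace ℂ E] [LinearOrder ι] [LocallyFiniteOrderBot ι] [WellFoundedLT ι]
    {V : Set X} {b : ι → X → E} (hb : ∀ i, ContinuousOn (b i) V)
    (hli : ∀ x ∈ V, LinearIndependent ℂ (fun i => b i x)) (i : ι) :
    ContinuousOn (fun x => InnerProductSpace.gramSchmidtNormed ℂ (fun i => b i x) i) V := by
  have h := continuousOn_gramSchmidt hb hli i
  refine ContinuousOn.smul (ContinuousOn.inv₀ ?_ ?_) h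
  · exact Complex.continuous_ofReal.comp_continuousOn h.norm
  · intro x hx
    have := InnerProductSpace.gramSchmidt_ne_zero (𝕜 := ℂ) i (hli x hx)
    simpa using this

theorem star_dotProduct_eq_zero_of_rootEigenspace {k n : ℕ} [NeZero k]
    {v : Matrix (Fin n) (Fin n) ℂ} (hv : v ∈ unitary (Matrix (Fin n) (Fin n) ℂ)) {i j : Fin k}
    (hij : i ≠ j) {ξ η : Fin n → ℂ} (hξ : ξ ∈ rootEigenspace k v i)
    (hη : η ∈ rootEigenspace k v j) : star ξ ⬝ᵥ η = 0 := by
  rw [mem_rootEigenspace] at hξ hη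
  have h : star (v.mulVec ξ) ⬝ᵥ v.mulVec η = star ξ ⬝ᵥ η := by
    rw [Matrix.star_mulVec, ← Matrix.dotProduct_mulVec, Matrix.mulVec_mulVec,
      ← Matrix.star_eq_conjTranspose, Unitary.star_mul_self_of_mem hv, Matrix.one_mulVec]
  rw [hξ, hη, star_smul, smul_dotProduct, dotProduct_smul, smul_smul, star_stdAddChar,
    ← AddChar.map_add_eq_mul, smul_eq_mul] at h
  have hne : ZMod.stdAddChar (N := k) (-((i : ℕ) : ZMod k) + ((j : ℕ) : ZMod k)) ≠ 1 := by
    intro h1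
    rw [← AddChar.map_zero_eq_one (ZMod.stdAddChar (N := k))] at h1
    have h2 := ZMod.injective_stdAddChar h1
    rw [neg_add_eq_zero] at h2
    exact hij ((natCast_fin_bijective k).1 h2)
  by_contra h0
  exact hne (mul_right_cancel₀ h0 (by rw [h, one_mul]))

/-- Continuous frames of the eigenspaces of unitaries `v x` with `(v x)^k = 1` diagonalize `v` by
a continuous family of unitaries (from an orthonormalization of the frames). -/
theorem exists_continuousOn_diagonalization {X : Type*} [TopologicalSpace X] {V : Set X}
    {k n : ℕ} [NeZero k] {v : X → Matrix (Fin n) (Fin n) ℂ}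
    (hv : ∀ x ∈ V, v x ∈ unitary (Matrix (Fin n) (Fin n) ℂ)) (hvk : ∀ x ∈ V, v x ^ k = 1)
    {d : Fin k → ℕ} {b : ∀ j, Fin (d j) → X → (Fin n → ℂ)}
    (hb : ∀ j i, ContinuousOn (b j i) V)
    (hli : ∀ j, ∀ x ∈ V, LinearIndependent ℂ (fun i => b j i x))
    (hspan : ∀ j, ∀ x ∈ V,
      Submodule.span ℂ (Set.range fun i => b j i x) = rootEigenspace k (v x) j) :
    ∃ u : X → Matrix (Fin n) ((j : Fin k) × Fin (d j)) ℂ, ContinuousOn u V ∧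
      ∀ x ∈ V, (u x).conjTranspose * u x = 1 ∧ u x * (u x).conjTranspose = 1 ∧
        v x * u x = u x * rootDiagonal k d := by
  let E := EuclideanSpace ℂ (Fin n)
  let τ : (Fin n → ℂ) ≃L[ℂ] E := (EuclideanSpace.equiv (Fin n) ℂ).symm
  let f : ∀ j, Fin (d j) → X → E := fun j i x => τ (b j i x)
  have hf : ∀ j i, ContinuousOn (f j i) V := fun j i => τ.continuous.comp_continuousOn (hb j i)
  have hfli : ∀ j, ∀ x ∈ V, LinearIndependent ℂ (fun i => f j i x) := fun j x hx =>
    (hli j x hx).map' τ.toLinearMap (LinearMap.ker_eq_bot.2 τ.injective)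
  let g : ∀ j, Fin (d j) → X → E := fun j i x =>
    InnerProductSpace.gramSchmidtNormed ℂ (fun i => f j i x) i
  have hg : ∀ j i, ContinuousOn (g j i) V := fun j i =>
    continuousOn_gramSchmidtNormed (hf j) (hfli j) i
  have hgspan : ∀ j, ∀ x ∈ V, Submodule.span ℂ (Set.range fun i => τ.symm (g j i x)) =
      rootEigenspace k (v x) j := by
    intro j x hx
    have h := InnerProductSpace.span_gramSchmidtNormed_range (𝕜 := ℂ) (fun i => f j i x)
    rw [InnerProductSpace.span_gramSchmidt] at h
    have h' := congrArg (Submodule.map (τ.symm.toLinearMap : E →ₗ[ℂ] (Fin n → ℂ))) h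
    rw [Submodule.map_span, Submodule.map_span, ← Set.range_comp, ← Set.range_comp] at h'
    rw [← hspan j x hx]
    refine h'.trans ?_
    congr 2
  have hgmem : ∀ j i, ∀ x ∈ V, τ.symm (g j i x) ∈ rootEigenspace k (v x) j := fun j i x hx => by
    rw [← hgspan j x hx]
    exact Submodule.subset_span ⟨i, rfl⟩
  let u : X → Matrix (Fin n) ((j : Fin k) × Fin (d j)) ℂ := fun x =>
    Matrix.of fun i p => τ.symm (g p.1 p.2 x) i
  have hcol : ∀ x p, (u x).mulVec (Pi.single p 1) = τ.symm (g p.1 p.2 x) := by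
    intro x p
    rw [Matrix.mulVec_single_one]
    rfl
  have huu : ∀ x ∈ V, (u x).conjTranspose * u x = 1 := by
    intro x hx
    ext p p'
    have hentry : ((u x).conjTranspose * u x) p p' =
        star (τ.symm (g p.1 p.2 x)) ⬝ᵥ τ.symm (g p'.1 p'.2 x) := rfl
    rw [hentry]
    obtain ⟨j, c⟩ := p
    obtain ⟨j', c'⟩ := p'
    by_cases hj : j = j'
    · subst hj
      have hon := orthonormal_iff_ite.1
        (InnerProductSpace.gramSchmidtNormed_orthonormal (𝕜 := ℂ) (hfli j x hx)) c c'
      have hin : inner ℂ (g j c x) (g j c' x) =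
          star (τ.symm (g j c x)) ⬝ᵥ τ.symm (g j c' x) := by
        rw [EuclideanSpace.inner_eq_star_dotProduct, dotProduct_comm]
        rfl
      rw [← hin]
      refine hon.trans ?_
      by_cases hc : c = c'
      · subst hc; simp
      · rw [if_neg hc, Matrix.one_apply_ne]
        intro h
        exact hc (by simpa using h)
    · rw [star_dotProduct_eq_zero_of_rootEigenspace (hv x hx) hj (hgmem j c x hx)
        (hgmem j' c' x hx), Matrix.one_apply_ne]
      intro h
      exact hj (congrArg Sigma.fst h)
  refine ⟨u, ?_, fun x hx => ⟨huu x hx, ?_, ?_⟩⟩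
  · refine continuousOn_pi.2 fun i => continuousOn_pi.2 fun p => ?_
    exact (continuous_apply i).comp_continuousOn (τ.symm.continuous.comp_continuousOn (hg p.1 p.2))
  · -- `u u*` fixes every eigenvector of `v`, and these span.
    have hfix : ∀ ξ, ξ ∈ LinearMap.eqLocus (Matrix.mulVecLin (u x * (u x).conjTranspose))
        LinearMap.id := by
      intro ξ
      have htop : ξ ∈ ⨆ j, rootEigenspace k (v x) j := by
        rw [iSup_rootEigenspace_eq_top (hvk x hx)]; trivial
      refine (iSup_le fun j => ?_ : _ ≤ LinearMap.eqLocus _ _) htop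
      rw [← hgspan j x hx, Submodule.span_le]
      rintro _ ⟨i, rfl⟩
      change (u x * (u x).conjTranspose).mulVec (τ.symm (g j i x)) = τ.symm (g j i x)
      rw [← hcol x ⟨j, i⟩, Matrix.mulVec_mulVec, Matrix.mul_assoc, huu x hx, Matrix.mul_one]
    refine Matrix.toLin'.injective (LinearMap.ext fun ξ => ?_)
    rw [Matrix.toLin'_one]
    exact hfix ξ
  · refine Matrix.toLin'.injective (LinearMap.pi_ext' fun p => LinearMap.ext_ring ?_)
    simp only [LinearMap.comp_apply, LinearMap.single_apply, Matrix.toLin'_apply]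
    rw [← Matrix.mulVec_mulVec, ← Matrix.mulVec_mulVec, hcol,
      mem_rootEigenspace.1 (hgmem p.1 p.2 x hx), rootDiagonal, Matrix.mulVec_single_one,
      ← hcol, ← Matrix.mulVec_smul]
    congr 1
    ext q
    by_cases hq : q = p
    · subst hq; simp
    · simp [hq, Matrix.diagonal_apply_ne]

/-! ### Cyclic systems of projections over open sets -/

theorem IsCyclicSystem.map {A B : Type*} [NonUnitalRing A] [StarRing A] [NonUnitalRing B]
    [StarRing B] {F : Type*} [FunLike F A B] [NonUnitalRingHomClass F A B] [StarHomClass F A B]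
    {k : ℕ} {θ : A → A} {θ' : B → B} {P : ZMod k → A} (hP : IsCyclicSystem θ P) (f : F)
    (hf : ∀ a, f (θ a) = θ' (f a)) : IsCyclicSystem θ' (fun h => f (P h)) where
  star_eq h := by rw [← map_star, hP.star_eq]
  mul_eq h h' := by
    rw [← map_mul, hP.mul_eq]
    split_ifs
    · rfl
    · exact map_zero f
  map_eq h := by rw [← hf, hP.map_eq]

theorem IsCyclicSystem.iterate {A : Type*} [NonUnitalRing A] [StarRing A] {k : ℕ}
    {θ : A → A} {P : ZMod k → A} (hP : IsCyclicSystem θ P) (m : ℕ) (h : ZMod k) :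
    θ^[m] (P h) = P (h - m) := by
  induction m with
  | zero => simp
  | succ m ih =>
    rw [Function.iterate_succ_apply', ih, hP.map_eq]
    congr 1
    push_cast
    ring

namespace MatrixBundle

variable {X : Type u} [TopologicalSpace X] (M : MatrixBundle.{u, v} X)

theorem continuousWithinAt_section_iff (s : ∀ x, M.Fiber x) {V : Set X} {x : X} {n : ℕ}
    (e : Bundle.Trivialization (Matrix (Fin n) (Fin n) ℂ)
      (Bundle.TotalSpace.proj : M.Total → X)) (hx : x ∈ e.baseSet) :
    ContinuousWithinAt (fun y => (⟨y, s y⟩ : M.Total)) V x ↔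
      ContinuousWithinAt (fun y => (e ⟨y, s y⟩).2) V x := by
  refine (e.tendsto_nhds_iff (z := (⟨x, s x⟩ : M.Total)) (e.mem_source.2 hx)).trans ?_
  exact and_iff_right (continuous_id.continuousWithinAt (s := V) (x := x))

theorem continuousAt_section_iff (s : ∀ x, M.Fiber x) {x : X} {n : ℕ}
    (e : Bundle.Trivialization (Matrix (Fin n) (Fin n) ℂ)
      (Bundle.TotalSpace.proj : M.Total → X)) (hx : x ∈ e.baseSet) :
    ContinuousAt (fun y => (⟨y, s y⟩ : M.Total)) x ↔
      ContinuousAt (fun y => (e ⟨y, s y⟩).2) x := by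
  rw [← continuousWithinAt_univ, ← continuousWithinAt_univ, M.continuousWithinAt_section_iff s e hx]

theorem continuousAt_sum_smul {ι : Type*} [Fintype ι] {c : ι → X → ℂ} {s : ι → ∀ x, M.Fiber x}
    {x : X} (hc : ∀ i, ContinuousAt (c i) x)
    (hs : ∀ i, ContinuousAt (fun y => (⟨y, s i y⟩ : M.Total)) x) :
    ContinuousAt (fun y => (⟨y, ∑ i, c i y • s i y⟩ : M.Total)) x := by
  obtain ⟨n, -, e, hx, he⟩ := M.locallyTrivial x
  refine (M.continuousAt_section_iff (fun y => ∑ i, c i y • s i y) e hx).2 ?_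
  have h : ContinuousAt (fun y => ∑ i, c i y • (e ⟨y, s i y⟩).2) x :=
    tendsto_finsetSum _ fun i _ => (hc i).smul ((M.continuousAt_section_iff (s i) e hx).1 (hs i))
  refine h.congr ?_
  filter_upwards [e.open_baseSet.mem_nhds hx] with y hy
  obtain ⟨φ, hφ⟩ := he y hy
  simp only [hφ, map_sum, map_smul]

/-- A section that is invertible at every point is invertible in `Γ(M)`. -/
theorem isUnit_sections_of_forall (s : M.sections) (hs : ∀ x, IsUnit (s.1 x)) : IsUnit s := by
  have hinv : (fun x => Ring.inverse (s.1 x)) ∈ M.sections := by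
    rw [mem_sections, continuous_section_iff]
    intro n e he x hx
    have hcont := (M.continuous_section_iff s.1).1 s.2 n e he x hx
    obtain ⟨φ, hφ⟩ := he x hx
    have hdet : (e ⟨x, s.1 x⟩).2.det ≠ 0 := by
      rw [hφ, ← isUnit_iff_ne_zero, ← Matrix.isUnit_iff_isUnit_det]
      exact (hs x).map φ
    have hri : ContinuousAt Ring.inverse (e ⟨x, s.1 x⟩).2.det := by
      rw [Ring.inverse_eq_inv']
      exact continuousAt_inv₀ hdet
    have hcomp := ContinuousAt.comp (f := fun y => (e ⟨y, s.1 y⟩).2)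
      (continuousAt_matrix_inv _ hri) hcont
    refine hcomp.congr ?_
    filter_upwards [e.open_baseSet.mem_nhds hx] with y hy
    obtain ⟨φ, hφ⟩ := he y hy
    simp only [Function.comp_apply, hφ]
    refine Matrix.inv_eq_right_inv ?_
    rw [← map_mul, Ring.mul_inverse_cancel _ (hs y), map_one]
  refine ⟨⟨s, ⟨_, hinv⟩, ?_, ?_⟩, rfl⟩
  · ext x
    exact Ring.mul_inverse_cancel _ (hs x)
  · ext x
    exact Ring.inverse_mul_cancel _ (hs x)

theorem isUnit_fiber_sum_smul {ι : Type*} [Fintype ι] {x : X} (P : ι → M.Fiber x)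
    (hP : ∀ i, IsStarProjection (P i)) (c : ι → ℝ) (hc : ∀ i, 0 ≤ c i)
    (S : Finset ι) (hS : ∀ i ∈ S, 0 < c i) (hu : IsUnit (∑ i ∈ S, P i)) :
    IsUnit (∑ i, (c i : ℂ) • P i) := by
  obtain ⟨n, -, ⟨φ⟩⟩ := M.exists_fiber_equiv x
  have h := isUnit_sum_smul_of_projections (fun i => φ (P i)) (fun i => (hP i).map φ) c hc S hS
    (by rw [← map_sum]; exact hu.map φ)
  simp only [← map_smul, ← map_sum] at h
  simpa using h.map φ.symm

namespace CyclicAction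

variable {M} {k : ℕ} (T : M.CyclicAction k)

/-- Over `U` there are `q` continuous families of cyclic systems of projections, for the generator
of `ℤ/k`, whose total sum is invertible. Outside `U` the projections need not be continuous. -/
def HasCyclicSystems [NeZero k] (q : ℕ) (U : Set X) : Prop :=
  ∃ P : Fin q → ZMod k → ∀ x, M.Fiber x,
    (∀ l h, ContinuousOn (fun x => (⟨x, P l h x⟩ : M.Total)) U) ∧
    (∀ l x, IsCyclicSystem (T.act x (Multiplicative.ofAdd 1)) (fun h => P l h x)) ∧
    ∀ x ∈ U, IsUnit (∑ l, ∑ h, P l h x)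

theorem isCyclicSystem_zero (x : X) :
    IsCyclicSystem (T.act x (Multiplicative.ofAdd 1)) (fun _ : ZMod k => (0 : M.Fiber x)) where
  star_eq _ := star_zero _
  mul_eq _ _ := by simp
  map_eq _ := map_zero _

/-- Diagonalize the inducing unitary section by a continuous unitary and carry over the systems of
projections of the constant diagonal matrix. -/
theorem IsTrivialOver.hasCyclicSystems [NeZero k] {q : ℕ} (hq : T.quotientSpread ≤ q) {V : Set X}
    (hV : T.IsTrivialOver V) : T.HasCyclicSystems q V := by
  obtain ⟨n, e, s, he, rfl, -, hact, hframe⟩ := hV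
  choose d b hb hfr using hframe
  choose φ hφ using he
  obtain hempty | ⟨x₀, hx₀⟩ := (e.baseSet).eq_empty_or_nonempty
  · rw [hempty]
    exact ⟨fun _ _ _ => 0, fun _ _ => continuousOn_empty _, fun _ x => T.isCyclicSystem_zero x,
      fun x hx => hx.elim⟩
  let w : X → Matrix (Fin n) (Fin n) ℂ := fun x => (e ⟨x, s x⟩).2
  have hgen : ∀ x (hx : x ∈ e.baseSet), T.IsFiberGenerator x (φ x hx) (w x) := by
    intro x hx
    obtain ⟨h1, h2, h3⟩ := hact x hx
    simp only [w, hφ x hx]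
    refine ⟨Unitary.map_mem (φ x hx) h1, by rw [← map_pow, h2, map_one], fun a => ?_⟩
    rw [h3, map_mul, map_mul, map_star]
  have hdim : ∀ j, d j = Module.finrank ℂ (rootEigenspace k (w x₀) j) := by
    intro j
    obtain ⟨hli, hspan⟩ := hfr j x₀ hx₀
    rw [← hspan, finrank_span_eq_card hli, Fintype.card_fin]
  obtain ⟨hpos, hle⟩ := matrixSpread_le_natCast_iff.1
    (T.quotientSpread_le_iff.1 hq x₀ n (φ x₀ hx₀) (w x₀) (hgen x₀ hx₀))
  simp only [← hdim] at hpos hle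
  obtain ⟨j₀, hj₀⟩ := Finite.exists_min d
  obtain ⟨P, hP, hPu⟩ := exists_cyclicSystems_rootDiagonal d (d j₀) q (hpos j₀) hj₀
    (fun j => hle j j₀)
  obtain ⟨u, hu, hud⟩ := exists_continuousOn_diagonalization
    (fun x hx => (hgen x hx).1) (fun x hx => (hgen x hx).2.1) hb
    (fun j x hx => (hfr j x hx).1) (fun j x hx => (hfr j x hx).2)
  classical
  let Q : Fin q → ZMod k → ∀ x, M.Fiber x := fun l h x =>
    if hx : x ∈ e.baseSet then (φ x hx).symm (u x * P l h * (u x).conjTranspose) else 0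
  have hQ : ∀ l h x (hx : x ∈ e.baseSet),
      Q l h x = (φ x hx).symm (u x * P l h * (u x).conjTranspose) := fun l h x hx => dif_pos hx
  refine ⟨Q, fun l h x hx => ?_, fun l x => ?_, fun x hx => ?_⟩
  · refine (M.continuousWithinAt_section_iff (Q l h) e hx).2 ?_
    have hc : ContinuousOn (fun x => u x * P l h * (u x).conjTranspose) e.baseSet := by
      rw [continuousOn_iff_continuous_domRestrict] at hu ⊢
      exact (hu.matrix_mul continuous_const).matrix_mul hu.matrix_conjTranspose
    refine (hc x hx).congr (fun y hy => ?_) ?_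
    · rw [hφ y hy, hQ l h y hy, StarAlgEquiv.apply_symm_apply]
    · rw [hφ x hx, hQ l h x hx, StarAlgEquiv.apply_symm_apply]
  · by_cases hx : x ∈ e.baseSet
    swap
    · simp only [Q, hx, dif_neg, not_false_eq_true]
      exact T.isCyclicSystem_zero x
    obtain ⟨hu1, hu2, hu3⟩ := hud x hx
    have hu3' : (u x).conjTranspose * star (w x) =
        star (rootDiagonal k d) * (u x).conjTranspose := by
      have := congrArg Matrix.conjTranspose hu3
      rwa [Matrix.conjTranspose_mul, Matrix.conjTranspose_mul] at this
    have hmat : IsCyclicSystem (fun a => w x * a * star (w x))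
        (fun h => u x * P l h * (u x).conjTranspose) := by
      refine ⟨fun h => ?_, fun h h' => ?_, fun h => ?_⟩
      · rw [Matrix.star_eq_conjTranspose, Matrix.conjTranspose_mul, Matrix.conjTranspose_mul,
          Matrix.conjTranspose_conjTranspose, ← Matrix.star_eq_conjTranspose (P l h),
          (hP l).star_eq, Matrix.mul_assoc]
      · calc u x * P l h * (u x).conjTranspose * (u x * P l h' * (u x).conjTranspose)
            = u x * P l h * ((u x).conjTranspose * u x) * P l h' * (u x).conjTranspose := by
              simp only [Matrix.mul_assoc]
          _ = u x * (P l h * P l h') * (u x).conjTranspose := by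
              rw [hu1, Matrix.mul_one, Matrix.mul_assoc (u x)]
          _ = _ := by
              rw [(hP l).mul_eq]
              split_ifs
              · rfl
              · rw [Matrix.mul_zero, Matrix.zero_mul]
      · calc w x * (u x * P l h * (u x).conjTranspose) * star (w x)
            = (w x * u x) * P l h * ((u x).conjTranspose * star (w x)) := by
              simp only [Matrix.mul_assoc]
          _ = u x * (rootDiagonal k d * P l h * star (rootDiagonal k d)) *
                (u x).conjTranspose := by
              rw [hu3, hu3']
              simp only [Matrix.mul_assoc]
          _ = _ := by rw [(hP l).map_eq h]
    simp only [hQ l _ x hx]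
    refine hmat.map (φ x hx).symm fun a => ?_
    apply EquivLike.injective (φ x hx)
    rw [(hgen x hx).2.2, StarAlgEquiv.apply_symm_apply, StarAlgEquiv.apply_symm_apply]
  · obtain ⟨hu1, hu2, -⟩ := hud x hx
    simp only [hQ _ _ x hx, ← map_sum]
    refine IsUnit.map (φ x hx).symm ?_
    simp only [← Matrix.sum_mul, ← Matrix.mul_sum]
    obtain ⟨⟨a, b, hab, hba⟩, ha⟩ := hPu
    rw [← ha]
    have h : u x * b * (u x).conjTranspose * (u x * a * (u x).conjTranspose) = 1 := by
      calc _ = u x * b * ((u x).conjTranspose * u x) * a * (u x).conjTranspose := by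
            simp only [Matrix.mul_assoc]
        _ = u x * (b * a) * (u x).conjTranspose := by
            rw [hu1, Matrix.mul_one, Matrix.mul_assoc (u x)]
        _ = 1 := by rw [hba, Matrix.mul_one, hu2]
    exact ⟨⟨_, _, mul_eq_one_comm.1 h, h⟩, rfl⟩

theorem IsPiecewiseTrivialOver.hasCyclicSystems [NeZero k] {q : ℕ} (hq : T.quotientSpread ≤ q)
    {U : Set X} (hU : T.IsPiecewiseTrivialOver U) : T.HasCyclicSystems q U := by
  obtain ⟨r, V, hVo, hVd, rfl, hV⟩ := hU
  choose P hPc hPs hPu using fun a => (hV a).hasCyclicSystems T hq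
  classical
  let Q : Fin q → ZMod k → ∀ x, M.Fiber x := fun l h x =>
    if hx : ∃ a, x ∈ V a then P hx.choose l h x else 0
  have hQ : ∀ l h a, ∀ x ∈ V a, Q l h x = P a l h x := by
    intro l h a x hx
    have hex : ∃ a, x ∈ V a := ⟨a, hx⟩
    have ha : hex.choose = a := by
      by_contra hne
      exact Set.disjoint_left.1 (hVd hne) hex.choose_spec hx
    simp only [Q]
    rw [dif_pos hex, ha]
  refine ⟨Q, fun l h x hx => ?_, fun l x => ?_, fun x hx => ?_⟩
  · obtain ⟨a, ha⟩ := Set.mem_iUnion.1 hx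
    refine ContinuousAt.continuousWithinAt ?_
    refine ((hPc a l h).continuousAt ((hVo a).mem_nhds ha)).congr ?_
    filter_upwards [(hVo a).mem_nhds ha] with y hy
    rw [hQ l h a y hy]
  · by_cases hx : ∃ a, x ∈ V a
    · obtain ⟨a, ha⟩ := hx
      simp only [hQ l _ a x ha]
      exact hPs a l x
    · simp only [Q, hx, dif_neg, not_false_eq_true]
      exact T.isCyclicSystem_zero x
  · obtain ⟨a, ha⟩ := Set.mem_iUnion.1 hx
    simp only [hQ _ _ a x ha]
    exact hPu a x ha

end CyclicAction

end MatrixBundle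

/-! ### The upper bound -/

namespace MatrixBundle

namespace CyclicAction

variable {X : Type u} [TopologicalSpace X] {M : MatrixBundle.{u, v} X} {k : ℕ} [NeZero k]
  (T : M.CyclicAction k)

/-- The section `x ↦ ∑ h, f_h(w(x)) P_h(x)` is continuous if the `P_h` are continuous on an open
neighbourhood `U` of the support of the cutoff function `w`. -/
theorem cutoff_mem_sections {U : Set X} (hU : IsOpen U) {w : X → unitInterval}
    (hw : Continuous w) (hwU : ∀ x ∉ U, ∀ᶠ y in nhds x, w y = 0)
    {P : ZMod k → ∀ x, M.Fiber x}
    (hP : ∀ h, ContinuousOn (fun x => (⟨x, P h x⟩ : M.Total)) U) (f : EquivariantCone k) :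
    (fun x => ∑ h, f h (w x) • P h x) ∈ M.sections := by
  rw [mem_sections, continuous_iff_continuousAt]
  intro x
  by_cases hx : x ∈ U
  · exact M.continuousAt_sum_smul (c := fun h y => f h (w y))
      (fun h => ((map_continuous (f h)).comp hw).continuousAt)
      (fun h => (hP h).continuousAt (hU.mem_nhds hx))
  · have h0 : ContinuousAt (fun y => (⟨y, 0⟩ : M.Total)) x :=
      ((M.mem_sections (s := 0)).1 M.sections.zero_mem).continuousAt
    refine h0.congr ?_
    filter_upwards [hwU x hx] with y hy
    simp [hy]

/-- The *-homomorphism `C_0((0,1]) ⊗ C(ℤ/k) → Γ(M)` given by cyclic systems of projections and a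
cutoff function `w`: it sends `f` to the section `x ↦ ∑ h, f_h(w(x)) P_h(x)`. -/
noncomputable def cutoffHom {U : Set X} (hU : IsOpen U) {w : X → unitInterval}
    (hw : Continuous w) (hwU : ∀ x ∉ U, ∀ᶠ y in nhds x, w y = 0)
    {P : ZMod k → ∀ x, M.Fiber x}
    (hP : ∀ h, ContinuousOn (fun x => (⟨x, P h x⟩ : M.Total)) U)
    (hPs : ∀ x, IsCyclicSystem (T.act x (Multiplicative.ofAdd 1)) (fun h => P h x)) :
    EquivariantCone k →⋆ₙₐ[ℂ] M.sections where
  toFun f := ⟨fun x => ∑ h, f h (w x) • P h x, cutoff_mem_sections hU hw hwU hP f⟩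
  map_smul' c f := by
    ext x
    change ∑ h, (c * f h (w x)) • P h x = c • ∑ h, f h (w x) • P h x
    simp only [mul_smul, Finset.smul_sum]
  map_zero' := by
    ext x
    change ∑ h, (0 : ℂ) • P h x = 0
    simp
  map_add' f g := by
    ext x
    change ∑ h, (f h (w x) + g h (w x)) • P h x =
      ∑ h, f h (w x) • P h x + ∑ h, g h (w x) • P h x
    simp only [add_smul, Finset.sum_add_distrib]
  map_mul' f g := by
    ext x
    change ∑ h, (f h (w x) * g h (w x)) • P h x =
      (∑ h, f h (w x) • P h x) * ∑ h, g h (w x) • P h x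
    simp only [Finset.sum_mul_sum, smul_mul_smul_comm, (hPs x).mul_eq, smul_ite, smul_zero,
      Finset.sum_ite_eq, Finset.mem_univ, if_true]
  map_star' f := by
    ext x
    change ∑ h, star (f h (w x)) • P h x = star (∑ h, f h (w x) • P h x)
    simp only [star_sum, star_smul, (hPs x).star_eq]

theorem cutoffHom_translate {U : Set X} (hU : IsOpen U) {w : X → unitInterval}
    (hw : Continuous w) (hwU : ∀ x ∉ U, ∀ᶠ y in nhds x, w y = 0)
    {P : ZMod k → ∀ x, M.Fiber x}
    (hP : ∀ h, ContinuousOn (fun x => (⟨x, P h x⟩ : M.Total)) U)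
    (hPs : ∀ x, IsCyclicSystem (T.act x (Multiplicative.ofAdd 1)) (fun h => P h x))
    (g : ZMod k) (f : EquivariantCone k) :
    T.cutoffHom hU hw hwU hP hPs (fun h => f (h + g)) =
      T.onSections (Multiplicative.ofAdd g) (T.cutoffHom hU hw hwU hP hPs f) := by
  ext x
  change ∑ h, f (h + g) (w x) • P h x =
    T.act x (Multiplicative.ofAdd g) (∑ h, f h (w x) • P h x)
  have hact : ∀ h, T.act x (Multiplicative.ofAdd g) (P h x) = P (h - g) x := by
    intro h
    rw [← ZMod.natCast_zmod_val g, ← act_iterate]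
    exact (hPs x).iterate g.val h
  simp only [map_sum, map_smul, hact]
  exact Fintype.sum_equiv (Equiv.addRight g) _ _ fun h => by simp

theorem weakLTDim_add_one_le_of_cover [CompactSpace X] [T2Space X] {q m : ℕ} (hq : q ≠ 0)
    {U : Fin (m + 1) → Set X} (hU : ∀ i, IsOpen (U i)) (hcover : (⋃ i, U i) = Set.univ)
    (hS : ∀ i, T.HasCyclicSystems q (U i)) :
    weakLTDim T.onSections + 1 ≤ ((q * (m + 1) : ℕ) : ℕ∞) := by
  choose P hPc hPs hPu using hS
  obtain ⟨p, hp⟩ := PartitionOfUnity.exists_isSubordinate isClosed_univ U hU hcover.ge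
  let w : Fin (m + 1) → X → unitInterval := fun i x => ⟨p i x, p.nonneg i x, p.le_one i x⟩
  have hw : ∀ i, Continuous (w i) := fun i => (p i).continuous.subtype_mk _
  have hwU : ∀ i, ∀ x ∉ U i, ∀ᶠ y in nhds x, w i y = 0 := by
    intro i x hx
    have hx' : x ∉ tsupport (p i) := fun h => hx (hp i h)
    filter_upwards [notMem_tsupport_iff_eventuallyEq.1 hx'] with y hy
    exact Subtype.ext hy
  let ρ : Fin (m + 1) × Fin q → (EquivariantCone k →⋆ₙₐ[ℂ] M.sections) := fun a =>
    T.cutoffHom (hU a.1) (hw a.1) (hwU a.1) (hPc a.1 a.2) (hPs a.1 a.2)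
  obtain ⟨N, hN⟩ : ∃ N, q * (m + 1) = N + 1 :=
    Nat.exists_eq_succ_of_ne_zero (Nat.mul_ne_zero hq (Nat.succ_ne_zero m))
  let ε : Fin (N + 1) ≃ Fin (m + 1) × Fin q :=
    (finCongr (by rw [← hN, mul_comm])).trans finProdFinEquiv.symm
  have hunit : IsUnit (∑ j, ρ (ε j) (fun _ => coneCoordinate)) := by
    rw [ε.sum_comp (fun a => ρ a (fun _ => coneCoordinate))]
    refine M.isUnit_sections_of_forall _ fun x => ?_
    obtain ⟨i, hi⟩ := p.exists_pos (Set.mem_univ x)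
    have hxi : x ∈ U i := hp i (subset_tsupport _ hi.ne')
    have heval : (∑ a, ρ a (fun _ => coneCoordinate)).1 x =
        ∑ b : (Fin (m + 1) × Fin q) × ZMod k, ((p b.1.1 x : ℝ) : ℂ) • P b.1.1 b.1.2 b.2 x := by
      rw [Fintype.sum_prod_type (fun b : (Fin (m + 1) × Fin q) × ZMod k =>
        ((p b.1.1 x : ℝ) : ℂ) • P b.1.1 b.1.2 b.2 x)]
      exact map_sum (M.evalFiber x) (fun a => ρ a (fun _ => coneCoordinate)) _
    rw [heval]
    refine M.isUnit_fiber_sum_smul (fun b : (Fin (m + 1) × Fin q) × ZMod k =>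
      P b.1.1 b.1.2 b.2 x) (fun b => (hPs b.1.1 b.1.2 x).isStarProjection b.2)
      (fun b => p b.1.1 x) (fun b => p.nonneg _ _)
      ((({i} : Finset (Fin (m + 1))) ×ˢ Finset.univ) ×ˢ Finset.univ) ?_ ?_
    · intro b hb
      simp only [Finset.mem_product, Finset.mem_singleton, Finset.mem_univ, and_true] at hb
      rw [hb]
      exact hi
    · rw [Finset.sum_product, Finset.sum_product, Finset.sum_singleton]
      exact hPu i x hxi
  rw [hN]
  push_cast
  gcongr
  refine sInf_le ⟨N, rfl, fun j => ρ (ε j), fun j g f => ?_, hunit⟩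
  exact T.cutoffHom_translate _ _ _ _ _ g f

theorem weakLTDim_add_one_le [CompactSpace X] [T2Space X] [Nonempty X] :
    weakLTDim T.onSections + 1 ≤ T.quotientSpread * (T.index + 1) := by
  have hq0 := T.quotientSpread_ne_zero
  by_cases hi : T.index = ⊤
  · rw [hi, top_add, ENat.mul_top hq0]
    exact le_top
  by_cases hq : T.quotientSpread = ⊤
  · rw [hq, ENat.top_mul (by simp)]
    exact le_top
  obtain ⟨q, hq⟩ := ENat.ne_top_iff_exists.1 hq
  have hne : {r : ℕ∞ | ∃ m : ℕ, r = m ∧ ∃ U : Fin (m + 1) → Set X,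
      (∀ i, IsOpen (U i)) ∧ (⋃ i, U i) = Set.univ ∧
        ∀ i, T.IsPiecewiseTrivialOver (U i)}.Nonempty := by
    by_contra h
    exact hi (by rw [index, Set.not_nonempty_iff_eq_empty.1 h, sInf_empty])
  obtain ⟨m, hm, U, hU, hcover, htriv⟩ := csInf_mem hne
  have h := T.weakLTDim_add_one_le_of_cover (q := q) (by rintro rfl; exact hq0 (by simp [← hq]))
    hU hcover (fun i => (htriv i).hasCyclicSystems T hq.ge)
  rw [index, hm, ← hq]
  exact_mod_cast h

end CyclicAction

end MatrixBundle

theorem mainTheorem4 {X : Type u} [TopologicalSpace X] [CompactSpace X] [T2Space X] [Nonempty X]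
    (M : MatrixBundle.{u, v} X) (k : ℕ) [NeZero k] (T : M.CyclicAction k) :
    T.quotientSpread ≤ weakLTDim T.onSections + 1 ∧
      weakLTDim T.onSections + 1 ≤ T.quotientSpread * (T.index + 1) :=
  ⟨T.quotientSpread_le_weakLTDim_add_one, T.weakLTDim_add_one_le⟩
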